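/- **Theorem (fine-scale behavior of $\gamma$-order linear processes).** *Conventions.* Let $d\ge 1$. A generalized random process on a probability space $(\Omega,\mathbb P)$ is a linear map $\varphi\mapsto\langle s,\varphi\rangle$ from the real Schwartz space $\mathcal S(\mathbb R^d)$ to the real random variables (modulo almost sure equality), sequentially continuous in probability; its characteristic functional is $\widehat{\mathcal P}_s(\varphi)=\mathbb E[e^{i\langle s,\varphi\rangle}]$. Equality in law and convergence in law refer to all finite-dimensional marginals $(\langle s,\varphi_1\rangle,\dots,\langle s,\varphi_N\rangle)$. The process $s(\cdot/a)$ is given by $\langle s(\cdot/a),\varphi\rangle=a^d\langle s,\varphi(a\,\cdot)\rangle$, and likewise $u(\cdot/a)$ for $u\in\mathcal S'(\mathbb R^d)$. The process $s$ is self-similar of order $H$ if $a^Hs(\cdot/a)$ and $s$ have the same law for all $a>0$; it is locally self-similar of order $H$ if $a^Hs(\cdot/a)$ converges in law, as $a\to\infty$, to a generalized random process that is not identically $0$. A Lévy white noise with Lévy exponent $\Psi:\mathbb R\to\mathbb C$ is a generalized random process $w$ with $\widehat{\mathcal P}_w(\varphi)=\exp\big(\int_{\mathbb R^d}\Psi(\varphi(x))\,dx\big)$,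 where $\Psi$ is continuous, $\Psi(0)=0$, and $e^{\Psi}$ is the characteristic function of an infinitely divisible law having a finite absolute moment of some order $\epsilon>0$. It is an S$\alpha$S white noise if $\Psi(\xi)=-C|\xi|^\alpha$ for some $C>0$. The Blumenthal–Getoor index of $\Psi$ is $\beta_\infty=\inf\{p\in[0,2]:\limsup_{|\xi|\to\infty}|\Psi(\xi)|/|\xi|^p<\infty\}$. *Hypotheses.* Let $w$ be a Lévy white noise with Lévy exponent $\Psi$ and index $\beta_\infty\in(0,2]$. Let $\gamma\ge 0$ and let $L:\mathcal S(\mathbb R^d)\to\mathcal S'(\mathbb R^d)$ be linear, continuous and $\gamma$-homogeneous, i.e. $L\{\varphi(\cdot/a)\}=a^{-\gamma}(L\varphi)(\cdot/a)$ for all $a>0$, with adjoint $L^*:\mathcal S(\mathbb R^d)\to\mathcal S'(\mathbb R^d)$, $\langle L^*\varphi_1,\varphi_2\rangle=\langle\varphi_1,L\varphi_2\rangle$. Let $T$ be a linear operator, with values in the real measurable functions modulo almost everywhere equality, defined on $\mathcal S(\mathbb R^d)+L^*(\mathcal S(\mathbb R^d))\subset\mathcal S'(\mathbb R^d)$ (which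 is $\mathcal S(\mathbb R^d)$ when $L^*$ maps $\mathcal S(\mathbb R^d)$ to itself), not identically $0$ on $\mathcal S(\mathbb R^d)$, which is a left inverse of $L^*$, i.e. $TL^*\varphi=\varphi$ for all $\varphi\in\mathcal S(\mathbb R^d)$, and which is $(-\gamma)$-homogeneous, i.e. $T\{\varphi(\cdot/a)\}=a^{\gamma}(T\varphi)(\cdot/a)$ for all $\varphi\in\mathcal S(\mathbb R^d)$ and $a>0$. Assume that one of the following holds: * (C1) $T$ is continuous from $\mathcal S(\mathbb R^d)$ to the Fréchet space $\mathcal R(\mathbb R^d)=\{f \text{ measurable}: (1+|\cdot|)^Nf\in L^2(\mathbb R^d)\text{ for all }N\in\mathbb N\}$; * (C2) $T$ is continuous from $\mathcal S(\mathbb R^d)$ to $L^{\beta_\infty}(\mathbb R^d)$, and there is $K>0$ with $|\Psi(\xi)|\le K|\xi|^{\beta_\infty}$ for all $\xi\in\mathbb R$. Let $s=L^{-1}w$ be the $\gamma$-order linear process, i.e. a generalized random process with $\widehat{\mathcal P}_s(\varphi)=\widehat{\mathcal P}_w(T\varphi)=\exp\big(\int_{\mathbb R^d}\Psi(T\varphi(x))\,dx\big)$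 for all $\varphi\in\mathcal S(\mathbb R^d)$. Assume that $\Psi(\xi)\sim-C|\xi|^{\beta_\infty}$ as $|\xi|\to\infty$ for some $C>0$, and put $H_{\mathrm{loc}}=\gamma+d\left(\frac1{\beta_\infty}-1\right)$. *Conclusion.* There exist, on some probability space, an S$\alpha$S white noise $w_{\beta_\infty}$ with $\alpha=\beta_\infty$ and Lévy exponent $-C|\xi|^{\beta_\infty}$, and a generalized random process $s_{L,\beta_\infty}$ with characteristic functional $\exp(-C\|T\varphi\|_{\beta_\infty}^{\beta_\infty})$ that solves $L s_{L,\beta_\infty}=w_{\beta_\infty}$, such that $$a^{\gamma+d\left(\frac1{\beta_\infty}-1\right)}\,s(\cdot/a)\ \xrightarrow[a\to\infty]{(d)}\ s_{L,\beta_\infty},$$ and $s_{L,\beta_\infty}$ is self-similar of order $H_{\mathrm{loc}}$. In particular, $s$ is locally self-similar of order $H_{\mathrm{loc}}$. Here $L s_{L,\beta_\infty}=w_{\beta_\infty}$ means that $s_{L,\beta_\infty}$ extends to a linear map $u\mapsto\langle s_{L,\beta_\infty},u\rangle$ from $\mathcal S(\mathbb R^d)+L^*(\mathcal S(\mathbb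 R^d))$ to the random variables with $\mathbb E[e^{i\langle s_{L,\beta_\infty},u\rangle}]=\exp(-C\|Tu\|_{\beta_\infty}^{\beta_\infty})$ for all $u$ and $\langle s_{L,\beta_\infty},L^*\varphi\rangle=\langle w_{\beta_\infty},\varphi\rangle$ for all $\varphi\in\mathcal S(\mathbb R^d)$. -/

import Mathlib

open MeasureTheory ProbabilityTheory Filter Topology
open scoped SchwartzMap ENNReal

noncomputable section

namespace LinearSDE

/-- The Euclidean space `ℝᵈ`. -/
abbrev Space (d : ℕ) : Type := EuclideanSpace ℝ (Fin d)

/-- Real tempered distributions on `ℝᵈ` (the weak-star topology is only used to express the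
continuity of operators with values in them). -/
abbrev TempDist (d : ℕ) : Type := 𝓢(Space d, ℝ) →Lₚₜ[ℝ] ℝ

/-- The dilation `φ ↦ φ(a ·)` of Schwartz functions, for `a ≠ 0` (and `0` if `a = 0`). -/
def dilate {d : ℕ} (a : ℝ) : 𝓢(Space d, ℝ) →L[ℝ] 𝓢(Space d, ℝ) :=
  if ha : a = 0 then 0
  else SchwartzMap.compCLMOfContinuousLinearEquiv ℝ
    (ContinuousLinearEquiv.smulLeft (R₁ := ℝ) (M₁ := Space d) (Units.mk0 a ha))

theorem dilate_apply {d : ℕ} {a : ℝ} (ha : a ≠ 0) (φ : 𝓢(Space d, ℝ)) (x : Space d) :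
    dilate a φ x = φ (a • x) := by
  simp [dilate, ha, Units.smul_def]

/-- The canonical embedding of Schwartz functions into tempered distributions,
`⟨φ, ψ⟩ = ∫ φ ψ`. -/
def embed (d : ℕ) : 𝓢(Space d, ℝ) →ₗ[ℝ] TempDist d where
  toFun φ := ContinuousLinearMap.toPointwiseConvergenceCLM ℝ (RingHom.id ℝ) 𝓢(Space d, ℝ) ℝ
    ((SchwartzMap.integralCLM ℝ (volume : Measure (Space d))).comp
      (SchwartzMap.pairing (ContinuousLinearMap.mul ℝ ℝ) φ))
  map_add' φ ψ := by ext χ; simp; rfl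
  map_smul' c φ := by ext χ; simp

theorem embed_apply {d : ℕ} (φ ψ : 𝓢(Space d, ℝ)) :
    embed d φ ψ = ∫ x, φ x * ψ x := rfl

/-! ### Generalized random processes -/

/-- A generalized random process on the probability space `(Ω, P)`: a linear map from Schwartz
functions to real random variables (up to almost sure equality) that is sequentially continuous
in probability. -/
structure GenProcess (d : ℕ) {Ω : Type*} [MeasurableSpace Ω] (P : Measure Ω) where
  toLin : 𝓢(Space d, ℝ) →ₗ[ℝ] (Ω →ₘ[P] ℝ)
  seqContinuous : ∀ (φ : ℕ → 𝓢(Space d, ℝ)) (φ₀ : 𝓢(Space d, ℝ)), Tendsto φ atTop (𝓝 φ₀) →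
    TendstoInMeasure P (fun n => (toLin (φ n) : Ω → ℝ)) atTop (toLin φ₀ : Ω → ℝ)

section Processes

variable {d : ℕ} {Ω : Type*} [MeasurableSpace Ω] {P : Measure Ω}
  {Ω' : Type*} [MeasurableSpace Ω'] {P' : Measure Ω'}

/-- The characteristic function `E[exp(i X)]` of a random variable `X` at `1`. -/
def expectExp (X : Ω →ₘ[P] ℝ) : ℂ := ∫ ω, Complex.exp (Complex.I * ((X ω : ℝ) : ℂ)) ∂P

/-- The characteristic functional `φ ↦ E[exp(i ⟨s, φ⟩)]`. -/
def charFunctional (s : GenProcess d P) (φ : 𝓢(Space d, ℝ)) : ℂ := expectExp (s.toLin φ)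

/-- Equality in law: equality of all finite-dimensional marginal laws. -/
def EqualInLaw (s : GenProcess d P) (s' : GenProcess d P') : Prop :=
  ∀ (N : ℕ) (φ : Fin N → 𝓢(Space d, ℝ)),
    IdentDistrib (fun ω i => s.toLin (φ i) ω) (fun ω i => s'.toLin (φ i) ω) P P'

/-- Convergence in law of a family of processes: convergence in distribution of all
finite-dimensional marginals. -/
def ConvergesInLaw [IsProbabilityMeasure P] [IsProbabilityMeasure P']
    (s : ℝ → GenProcess d P) (l : Filter ℝ) (s' : GenProcess d P') : Prop :=
  ∀ (N : ℕ) (φ : Fin N → 𝓢(Space d, ℝ)),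
    TendstoInDistribution (fun a ω i => (s a).toLin (φ i) ω) l (fun ω i => s'.toLin (φ i) ω)
      (fun _ => P) P'

theorem tendstoInMeasure_const_smul {X : ℕ → (Ω →ₘ[P] ℝ)} {X₀ : Ω →ₘ[P] ℝ} (c : ℝ)
    (h : TendstoInMeasure P (fun n => (X n : Ω → ℝ)) atTop (X₀ : Ω → ℝ)) :
    TendstoInMeasure P (fun n => ((c • X n : Ω →ₘ[P] ℝ) : Ω → ℝ)) atTop
      ((c • X₀ : Ω →ₘ[P] ℝ) : Ω → ℝ) := by
  have h2 : TendstoInMeasure P (fun n => c • (X n : Ω → ℝ)) atTop (c • (X₀ : Ω → ℝ)) := by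
    rcases eq_or_ne c 0 with rfl | hc
    · intro ε hε
      simp [hε.ne']
    · have hc' : 0 < ‖c‖ := norm_pos_iff.2 hc
      rw [tendstoInMeasure_iff_norm] at h ⊢
      intro ε hε
      refine (h (ε / ‖c‖) (div_pos hε hc')).congr fun n => ?_
      congr 1
      ext ω
      simp only [Set.mem_ofPred_eq, Pi.smul_apply]
      rw [← smul_sub, norm_smul, div_le_iff₀' hc']
  exact h2.congr (fun n => (AEEqFun.coeFn_smul c (X n)).symm) (AEEqFun.coeFn_smul c X₀).symm

/-- The rescaled process `a ^ H s(· / a)`, where `⟨s(· / a), φ⟩ = a ^ d ⟨s, φ(a ·)⟩`. -/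
def rescale (s : GenProcess d P) (H a : ℝ) : GenProcess d P where
  toLin := (a ^ H * a ^ d) • (s.toLin ∘ₗ (dilate a : 𝓢(Space d, ℝ) →L[ℝ] 𝓢(Space d, ℝ)).toLinearMap)
  seqContinuous _ φ₀ h := tendstoInMeasure_const_smul _
    (s.seqContinuous _ _ (((dilate a).continuous.tendsto φ₀).comp h))

/-- Self-similarity of order `H`: `a ^ H s(· / a)` has the law of `s` for all `a > 0`. -/
def IsSelfSimilar (s : GenProcess d P) (H : ℝ) : Prop :=
  ∀ a : ℝ, 0 < a → EqualInLaw (rescale s H a) s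

/-- Local self-similarity of order `H`: `a ^ H s(· / a)` converges in law, as `a → ∞`, to a
generalized random process that is not identically zero. -/
def IsLocallySelfSimilar [IsProbabilityMeasure P] (s : GenProcess d P) (H : ℝ) : Prop :=
  ∃ (Ω₁ : Type) (_ : MeasurableSpace Ω₁) (P₁ : Measure Ω₁) (_ : IsProbabilityMeasure P₁)
    (s₁ : GenProcess d P₁),
    s₁.toLin ≠ 0 ∧ ConvergesInLaw (fun a => rescale s H a) atTop s₁

end Processes

/-! ### Lévy exponents and Lévy white noises -/

/-- A law on `ℝ` is infinitely divisible if for every `N ≥ 1` it is the law of a sum of `N`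
independent identically distributed random variables. -/
def IsInfinitelyDivisible (μ : Measure ℝ) : Prop :=
  ∀ N : ℕ, 1 ≤ N → ∃ ν : Measure ℝ, IsProbabilityMeasure ν ∧
    (Measure.pi (fun _ : Fin N => ν)).map (fun x => ∑ i, x i) = μ

/-- `Ψ` is a Lévy exponent (the continuous logarithm, vanishing at `0`, of the characteristic
function of an infinitely divisible law `μ`) such that `μ` has a finite absolute moment of some
order `ε > 0`. -/
def IsTemperedLevyExponent (Ψ : ℝ → ℂ) : Prop :=
  Continuous Ψ ∧ Ψ 0 = 0 ∧
  ∃ μ : Measure ℝ, IsProbabilityMeasure μ ∧ IsInfinitelyDivisible μ ∧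
    (∀ ξ : ℝ, charFun μ ξ = Complex.exp (Ψ ξ)) ∧
    ∃ ε : ℝ, 0 < ε ∧ Integrable (fun x : ℝ => |x| ^ ε) μ

/-- The functional `f ↦ exp (∫ Ψ(f(x)) dx)` on (classes of) measurable functions. -/
def levyFunctional {d : ℕ} (Ψ : ℝ → ℂ) (f : Space d → ℝ) : ℂ :=
  Complex.exp (∫ x, Ψ (f x))

/-- `w` is a (tempered) Lévy white noise with Lévy exponent `Ψ`. -/
def IsLevyWhiteNoise {d : ℕ} {Ω : Type*} [MeasurableSpace Ω] {P : Measure Ω}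
    (w : GenProcess d P) (Ψ : ℝ → ℂ) : Prop :=
  IsTemperedLevyExponent Ψ ∧
    ∀ φ : 𝓢(Space d, ℝ), charFunctional w φ = levyFunctional Ψ φ

/-- The symmetric stable exponent `ξ ↦ - C |ξ| ^ α`. -/
def stableExponent (C α : ℝ) (ξ : ℝ) : ℂ := ((-C * |ξ| ^ α : ℝ) : ℂ)

/-- The Blumenthal–Getoor index of `Ψ`, the infimum of the `p ∈ [0, 2]` such that
`limsup |Ψ(ξ)| / |ξ| ^ p < ∞` as `|ξ| → ∞`. -/
def blumenthalGetoorIndex (Ψ : ℝ → ℂ) : ℝ :=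
  sInf {p : ℝ | p ∈ Set.Icc 0 2 ∧
    limsup (fun ξ : ℝ => ENNReal.ofReal (‖Ψ ξ‖ / |ξ| ^ p)) (Bornology.cobounded ℝ) < ⊤}

/-- `p`-admissibility: `|Ψ(ξ)| ≤ K |ξ| ^ p` for some `K > 0` and all `ξ`. -/
def IsAdmissible (Ψ : ℝ → ℂ) (p : ℝ) : Prop :=
  ∃ K : ℝ, 0 < K ∧ ∀ ξ : ℝ, ‖Ψ ξ‖ ≤ K * |ξ| ^ p

/-! ### Operators -/

section Operators

variable {d : ℕ}

/-- `L {φ(· / a)} = a ^ (-γ) (L φ)(· / a)` for all `φ` and all `a > 0`, where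
`⟨u(· / a), ψ⟩ = ⟨u, a ^ d ψ(a ·)⟩` for a tempered distribution `u`. -/
def IsHomogeneousOp (L : 𝓢(Space d, ℝ) →L[ℝ] TempDist d) (γ : ℝ) : Prop :=
  ∀ (a : ℝ), 0 < a → ∀ φ ψ : 𝓢(Space d, ℝ),
    L (dilate a⁻¹ φ) ψ = a ^ (-γ) * L φ ((a ^ d) • dilate a ψ)

/-- The adjoint operator, `⟨L* φ₁, φ₂⟩ = ⟨φ₁, L φ₂⟩`. -/
def adjointOp (L : 𝓢(Space d, ℝ) →L[ℝ] TempDist d) : 𝓢(Space d, ℝ) →ₗ[ℝ] TempDist d where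
  toFun φ := ContinuousLinearMap.toPointwiseConvergenceCLM ℝ (RingHom.id ℝ) 𝓢(Space d, ℝ) ℝ
    ((PointwiseConvergenceCLM.evalCLM (RingHom.id ℝ) ℝ φ).comp L)
  map_add' φ ψ := by ext χ; exact map_add (L χ) φ ψ
  map_smul' c φ := by ext χ; exact map_smul (L χ) c φ

theorem adjointOp_apply (L : 𝓢(Space d, ℝ) →L[ℝ] TempDist d) (φ₁ φ₂ : 𝓢(Space d, ℝ)) :
    adjointOp L φ₁ φ₂ = L φ₂ φ₁ := rfl

/-- The space `𝓢 + L*(𝓢)` of tempered distributions. It is (the embedded copy of) `𝓢` itself when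
`L*` maps `𝓢` to `𝓢`. A left inverse of `L*` that is defined on `𝓢` has to be defined on this
space. -/
def opDomain (L : 𝓢(Space d, ℝ) →L[ℝ] TempDist d) : Submodule ℝ (TempDist d) :=
  LinearMap.range (embed d) ⊔ LinearMap.range (adjointOp L)

/-- A Schwartz function as an element of `𝓢 + L*(𝓢)`. -/
def ofSchwartz (L : 𝓢(Space d, ℝ) →L[ℝ] TempDist d) : 𝓢(Space d, ℝ) →ₗ[ℝ] opDomain L :=
  (embed d).codRestrict (opDomain L) fun φ =>
    Submodule.mem_sup_left (LinearMap.mem_range_self (embed d) φ)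

/-- `L* φ` as an element of `𝓢 + L*(𝓢)`. -/
def adjointTo (L : 𝓢(Space d, ℝ) →L[ℝ] TempDist d) : 𝓢(Space d, ℝ) →ₗ[ℝ] opDomain L :=
  (adjointOp L).codRestrict (opDomain L) fun φ =>
    Submodule.mem_sup_right (LinearMap.mem_range_self (adjointOp L) φ)

variable {L : 𝓢(Space d, ℝ) →L[ℝ] TempDist d}

/-- `T` is a left inverse of `L*`: `T L* φ = φ` (almost everywhere) for every `φ ∈ 𝓢`. -/
def IsLeftInverse (T : opDomain L →ₗ[ℝ] (Space d →ₘ[volume] ℝ)) : Prop :=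
  ∀ φ : 𝓢(Space d, ℝ), T (adjointTo L φ) =ᵐ[volume] φ

/-- `T {φ(· / a)} = a ^ (-κ) (T φ)(· / a)` for all `φ ∈ 𝓢` and all `a > 0`. -/
def IsHomogeneousInverse (T : opDomain L →ₗ[ℝ] (Space d →ₘ[volume] ℝ)) (κ : ℝ) : Prop :=
  ∀ (a : ℝ), 0 < a → ∀ φ : 𝓢(Space d, ℝ),
    T (ofSchwartz L (dilate a⁻¹ φ)) =ᵐ[volume] fun x => a ^ (-κ) * T (ofSchwartz L φ) (a⁻¹ • x)

/-- `T` maps `𝓢` continuously to `L ^ p`, `0 < p < ∞` (with its usual quasi-norm if `p < 1`). -/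
def ContinuousToLp (T : opDomain L →ₗ[ℝ] (Space d →ₘ[volume] ℝ)) (p : ℝ) : Prop :=
  (∀ φ : 𝓢(Space d, ℝ), MemLp (T (ofSchwartz L φ)) (ENNReal.ofReal p) volume) ∧
  ∀ φ₀ : 𝓢(Space d, ℝ), Tendsto
    (fun φ : 𝓢(Space d, ℝ) => eLpNorm (fun x => T (ofSchwartz L φ) x - T (ofSchwartz L φ₀) x)
      (ENNReal.ofReal p) volume) (𝓝 φ₀) (𝓝 0)

/-- `T` maps `𝓢` continuously to the Fréchet space of rapidly decaying measurable functions `f`,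
those with `(1 + |·|) ^ N f ∈ L²` for all `N`, whose topology is given by the norms
`‖(1 + |·|) ^ N f‖₂`. -/
def ContinuousToRapidDecay (T : opDomain L →ₗ[ℝ] (Space d →ₘ[volume] ℝ)) : Prop :=
  ∀ N : ℕ,
    (∀ φ : 𝓢(Space d, ℝ), MemLp (fun x => (1 + ‖x‖) ^ N * T (ofSchwartz L φ) x) 2 volume) ∧
    ∀ φ₀ : 𝓢(Space d, ℝ), Tendsto
      (fun φ : 𝓢(Space d, ℝ) => eLpNorm
        (fun x => (1 + ‖x‖) ^ N * (T (ofSchwartz L φ) x - T (ofSchwartz L φ₀) x)) 2 volume)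
      (𝓝 φ₀) (𝓝 0)

variable {Ω : Type*} [MeasurableSpace Ω] {P : Measure Ω}

/-- `s` is the linear process `L⁻¹ w` built from the left inverse `T` and a white noise with Lévy
exponent `Ψ`: its characteristic functional is `φ ↦ exp (∫ Ψ(T φ))`. -/
def IsLinearProcess (T : opDomain L →ₗ[ℝ] (Space d →ₘ[volume] ℝ)) (Ψ : ℝ → ℂ)
    (s : GenProcess d P) : Prop :=
  ∀ φ : 𝓢(Space d, ℝ), charFunctional s φ = levyFunctional Ψ (T (ofSchwartz L φ))

/-- The linear process `s = L⁻¹ w` solves `L s = w`, where `⟨L s, φ⟩ = ⟨s, L* φ⟩`. Since `L* φ` may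
fail to be a Schwartz function, this involves the linear extension `u ↦ ⟨s, u⟩` of `s` to
`𝓢 + L*(𝓢)` with characteristic functional `u ↦ exp (∫ Ψ(T u))`. -/
def SolvesSDE (T : opDomain L →ₗ[ℝ] (Space d →ₘ[volume] ℝ)) (Ψ : ℝ → ℂ)
    (s w : GenProcess d P) : Prop :=
  ∃ S : opDomain L →ₗ[ℝ] (Ω →ₘ[P] ℝ),
    (∀ φ : 𝓢(Space d, ℝ), S (ofSchwartz L φ) = s.toLin φ) ∧
    (∀ u : opDomain L, expectExp (S u) = levyFunctional Ψ (T u)) ∧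
    ∀ φ : 𝓢(Space d, ℝ), S (adjointTo L φ) = w.toLin φ

end Operators

end LinearSDE

end

open LinearSDE

/-! Homogeneity of `T` and the change of variables `x ↦ a x` turn the characteristic functional of
the rescaled process into `exp ∫ v⁻¹ Ψ(v^(1/β) Tφ(x)) dx` with `v = a^d` (`charFunctional_rescale`).
Since `Ψ(ξ) ~ -C|ξ|^β` at infinity, the integrand tends pointwise to `-C|Tφ(x)|^β`. Domination comes
from `‖Ψ ξ‖ ≤ K(|ξ|^ε + |ξ|^β)` with `ε ≤ β`: for `v ≥ 1` the factor `v⁻¹` absorbs `v^(ε/β)` and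
`v^(β/β)` (`tendsto_integral_inv_mul_comp`). Near `0` this bound follows from the moment of the Lévy
law under rapid decay, and from admissibility, with `ε = β`, in the other case.

The limit must be realized as a process. The existence of the one-dimensional stable law is read off
the convergence itself: `exp(-C|κt|^β)`, with `κ = ‖Tφ‖_β > 0`, is a limit of characteristic
functions that is continuous at `0` (`isCharFun_stable_of_linearProcess`). Joint laws follow by
approximating vector-valued `L^β` functions by simple ones (`isCharFun_stable`), and Kolmogorov's
theorem assembles them into one random field `S` on the whole of `𝓢 + L*(𝓢)`, linear because a
variable whose multiples all have `E[exp(i·)] = 1` vanishes almost surely (`exists_stable_field`).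

Restricting `S` to `𝓢` gives the limit process, and composing it with `L*` gives the noise, so the
equation holds by construction; `T L* = id` identifies the noise law. Self-similarity is the exact
homogeneity of `|ξ|^β`. -/

namespace LinearSDE

/-! ### Kolmogorov extension for real-valued families over an arbitrary index set -/

section KolmogorovExtension

variable {ι : Type*} {P : ∀ J : Finset ι, Measure (J → ℝ)}

/-- A decreasing sequence of nonempty compact cylinders has a common point. -/
theorem exists_forall_restrict_mem_of_isCompact {I : ℕ → Finset ι} {K : ∀ n, Set (I n → ℝ)}
    (hK : ∀ n, IsCompact (K n))
    (h : ∀ n, ∃ x : ι → ℝ, ∀ k ≤ n, (I k).restrict x ∈ K k) :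
    ∃ x : ι → ℝ, ∀ k, (I k).restrict x ∈ K k := by
  choose x hx using h
  let U : Ultrafilter ℕ := Filter.hyperfilter ℕ
  have hU : (U : Filter ℕ) ≤ atTop := Nat.hyperfilter_le_atTop
  -- Coordinates outside every `I k` need not converge; `limUnder` is then a junk value that no
  -- constraint sees.
  refine ⟨fun i => limUnder (U : Filter ℕ) fun n => x n i, fun k => ?_⟩
  have hmem : ∀ᶠ n in (U : Filter ℕ), (I k).restrict (x n) ∈ K k :=
    hU (eventually_atTop.2 ⟨k, fun n hn => hx n k hn⟩)
  obtain ⟨y, hyK, hy⟩ := (hK k).ultrafilter_le_nhds (U.map fun n => (I k).restrict (x n))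
    (le_principal_iff.2 hmem)
  have hy' : Tendsto (fun n => (I k).restrict (x n)) (U : Filter ℕ) (𝓝 y) := hy
  convert hyK using 1
  ext i
  exact ((tendsto_pi_nhds.1 hy') i).limUnder_eq

/-- Continuity at `∅`, the input for countable additivity. If the contents stayed above some `ε >
0`, inner regularity would give compact bases losing less than `ε` in total; finitely many of the
compact cylinders always meet, so all of them do, contradicting the empty intersection. -/
theorem projectiveFamilyContent_tendsto_zero [∀ J, IsFiniteMeasure (P J)]
    (hP : IsProjectiveMeasureFamily (α := fun _ : ι => ℝ) P) ⦃A : ℕ → Set (ι → ℝ)⦄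
    (hA : ∀ n, A n ∈ measurableCylinders fun _ : ι => ℝ) (hanti : Antitone A)
    (hempty : ⋂ n, A n = ∅) :
    Tendsto (fun n => projectiveFamilyContent hP (A n)) atTop (𝓝 0) := by
  have hmono : Antitone fun n => projectiveFamilyContent hP (A n) := fun m n hmn =>
    projectiveFamilyContent_mono hP (hA n) (hA m) (hanti hmn)
  have hlim := tendsto_atTop_iInf hmono
  set ε := ⨅ n, projectiveFamilyContent hP (A n) with hε
  suffices h0 : ε = 0 by rwa [h0] at hlim
  by_contra hne
  have hle : ∀ n, ε ≤ projectiveFamilyContent hP (A n) := fun n => iInf_le _ n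
  choose I S hS hAS using fun n => (mem_measurableCylinders _).1 (hA n)
  obtain ⟨δ, hδ, hδε⟩ := ENNReal.exists_pos_sum_of_countable' hne ℕ
  choose K hKS hK hKδ using fun n =>
    (hS n).exists_isCompact_sdiff_lt (μ := P (I n)) (measure_ne_top _ _) (hδ n).ne'
  have hdiff : ∀ n, A n \ cylinder (α := fun _ : ι => ℝ) (I n) (K n)
      = cylinder (α := fun _ : ι => ℝ) (I n) (S n \ K n) := fun n => by
    rw [hAS n]; rfl
  have hmeas : ∀ n, MeasurableSet (S n \ K n) := fun n => (hS n).diff (hK n).measurableSet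
  obtain ⟨x, hx⟩ := exists_forall_restrict_mem_of_isCompact hK fun n => by
    by_contra! hno
    have hsub : A n ⊆ ⋃ k ≤ n, cylinder (α := fun _ : ι => ℝ) (I k) (S k \ K k) := fun x hx => by
      obtain ⟨k, hkn, hk⟩ := hno x
      refine Set.mem_iUnion₂.2 ⟨k, hkn, ?_⟩
      rw [← hdiff]
      exact ⟨hanti hkn hx, hk⟩
    have hcyl : ∀ k, cylinder (α := fun _ : ι => ℝ) (I k) (S k \ K k) ∈ measurableCylinders fun _ : ι => ℝ := fun k =>
      cylinder_mem_measurableCylinders _ _ (hmeas k)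
    have h1 : projectiveFamilyContent hP (A n) ≤ ∑ k ∈ Finset.range (n + 1), δ k := by
      refine ((projectiveFamilyContent_mono hP (hA n) ?_ hsub).trans
        (projectiveFamilyContent_iUnion_le hP hcyl n)).trans (Finset.sum_le_sum fun k _ => ?_)
      · have hU : ⋃ k ≤ n, cylinder (α := fun _ : ι => ℝ) (I k) (S k \ K k)
            = ⋃ k ∈ Finset.range (n + 1), cylinder (α := fun _ : ι => ℝ) (I k) (S k \ K k) := by
          simp only [Finset.mem_range_succ_iff]
        rw [hU]
        exact isSetRing_measurableCylinders.biUnion_mem _ fun k _ => hcyl k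
      · rw [projectiveFamilyContent_cylinder hP (hmeas k)]
        exact (hKδ k).le
    exact absurd ((hle n).trans (h1.trans (ENNReal.sum_le_tsum _))) (not_le.2 hδε)
  have : x ∈ ⋂ n, A n := Set.mem_iInter.2 fun n => by
    rw [hAS n]
    exact hKS n (hx n)
  simp [hempty] at this

/-- **Kolmogorov's extension theorem** for real-valued families. -/
theorem exists_isProjectiveLimit [∀ J, IsFiniteMeasure (P J)] (hP : IsProjectiveMeasureFamily (α := fun _ : ι => ℝ) P) :
    ∃ μ : Measure (ι → ℝ), IsProjectiveLimit (α := fun _ : ι => ℝ) μ P := by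
  have hsub : (projectiveFamilyContent hP).IsSigmaSubadditive :=
    isSigmaSubadditive_of_addContent_iUnion_eq_tsum isSetRing_measurableCylinders
      fun f hf hfU hf' => addContent_iUnion_eq_sum_of_tendsto_zero isSetRing_measurableCylinders
        _ (fun s _ => projectiveFamilyContent_ne_top hP)
        (projectiveFamilyContent_tendsto_zero hP) hf hfU hf'
  refine ⟨(projectiveFamilyContent hP).measure isSetSemiring_measurableCylinders
    generateFrom_measurableCylinders.ge hsub, fun I => ?_⟩
  ext s hs
  rw [Measure.map_apply (Finset.measurable_restrict I) hs, AddContent.measure_eq, ← cylinder,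
    projectiveFamilyContent_cylinder hP hs]
  · exact generateFrom_measurableCylinders.symm
  · exact cylinder_mem_measurableCylinders _ _ hs

end KolmogorovExtension

/-! ### Closure properties of characteristic functions -/

section CharFun

variable {E : Type*} [NormedAddCommGroup E] [InnerProductSpace ℝ E] [FiniteDimensional ℝ E]
  [MeasurableSpace E] [BorelSpace E]

/-- `f` is the characteristic function of some probability measure. -/
def IsCharFun (f : E → ℂ) : Prop :=
  ∃ μ : Measure E, IsProbabilityMeasure μ ∧ ∀ t, charFun μ t = f t

omit [FiniteDimensional ℝ E] in
theorem isCharFun_one : IsCharFun (fun _ : E => (1 : ℂ)) :=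
  ⟨Measure.dirac 0, inferInstance, fun t => by simp [charFun_dirac]⟩

theorem IsCharFun.mul {f g : E → ℂ} (hf : IsCharFun f) (hg : IsCharFun g) :
    IsCharFun (fun t => f t * g t) := by
  obtain ⟨μ, _, hμ⟩ := hf
  obtain ⟨ν, _, hν⟩ := hg
  exact ⟨μ ∗ ν, inferInstance, fun t => by rw [charFun_conv, hμ, hν]⟩

theorem IsCharFun.prod {κ : Type*} (s : Finset κ) {f : κ → E → ℂ}
    (hf : ∀ k ∈ s, IsCharFun (f k)) : IsCharFun (fun t => ∏ k ∈ s, f k t) := by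
  classical
  induction s using Finset.induction_on with
  | empty => simpa using isCharFun_one
  | insert a s ha ih =>
    simp only [Finset.prod_insert ha]
    exact (hf a (Finset.mem_insert_self a s)).mul
      (ih fun k hk => hf k (Finset.mem_insert_of_mem hk))

omit [FiniteDimensional ℝ E] in
theorem IsCharFun.comp_inner {f : ℝ → ℂ} (hf : IsCharFun f) (y : E) :
    IsCharFun (fun t : E => f (inner ℝ y t)) := by
  obtain ⟨μ, _, hμ⟩ := hf
  have hm : Measurable fun z : ℝ => z • y := by fun_prop
  refine ⟨μ.map fun z => z • y, Measure.isProbabilityMeasure_map hm.aemeasurable, fun t => ?_⟩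
  change charFun _ t = f (inner ℝ y t)
  rw [charFun_apply, integral_map hm.aemeasurable (by fun_prop), ← hμ, charFun_apply_real]
  refine integral_congr_ae (ae_of_all _ fun z => ?_)
  simp only [inner_smul_left, conj_trivial, Complex.ofReal_mul]
  ring_nf

/-- The form of Lévy's continuity theorem that produces the limit law: continuity at `0` forces
tightness, and a limit along an ultrafilter exists by Prokhorov compactness. -/
theorem IsCharFun.of_tendsto {f : ℕ → E → ℂ} {g : E → ℂ} (hf : ∀ n, IsCharFun (f n))
    (hg : ContinuousAt g 0) (h : ∀ t, Tendsto (fun n => f n t) atTop (𝓝 (g t))) :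
    IsCharFun g := by
  choose μ hμ hμf using hf
  let ν : ℕ → ProbabilityMeasure E := fun n => ⟨μ n, hμ n⟩
  have hν : ∀ t, Tendsto (fun n => charFun (μ n) t) atTop (𝓝 (g t)) := fun t => by
    simpa only [hμf] using h t
  have htight : IsTightMeasureSet (Set.range μ) := isTightMeasureSet_of_tendsto_charFun hg hν
  have hc : IsCompact (closure (Set.range ν)) := by
    refine isCompact_closure_of_isTightMeasureSet ?_
    convert htight using 1
    ext m
    simp only [Set.mem_ofPred_eq, Set.mem_range, ν]
    exact ⟨fun ⟨_, ⟨n, hn⟩, h⟩ => ⟨n, by rw [← h, ← hn]; rfl⟩, fun ⟨n, hn⟩ => ⟨_, ⟨n, rfl⟩, hn⟩⟩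
  let U : Ultrafilter ℕ := Filter.hyperfilter ℕ
  have hU : (U : Filter ℕ) ≤ atTop := Nat.hyperfilter_le_atTop
  obtain ⟨ν₀, -, hν₀⟩ := hc.ultrafilter_le_nhds (U.map ν)
    (le_principal_iff.2 (Filter.mem_map.2
      (Eventually.of_forall fun n => subset_closure (Set.mem_range_self n))))
  have hν₀' : Tendsto ν (U : Filter ℕ) (𝓝 ν₀) := hν₀
  refine ⟨ν₀, inferInstance, fun t => ?_⟩
  rw [ProbabilityMeasure.tendsto_iff_forall_integral_rclike_tendsto ℂ] at hν₀'
  have h1 := hν₀' (BoundedContinuousFunction.innerProbChar t)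
  simp_rw [← charFun_eq_integral_innerProbChar] at h1
  exact tendsto_nhds_unique h1 ((hν t).mono_left hU)

end CharFun

/-! ### Multivariate stable characteristic functions -/

section Stable

variable {C β : ℝ}

theorem continuous_stableExponent (hβ : 0 < β) : Continuous (stableExponent C β) := by
  unfold stableExponent
  exact Complex.continuous_ofReal.comp
    (continuous_const.mul (continuous_abs.rpow_const fun _ => Or.inr hβ.le))

theorem stableExponent_zero (hβ : 0 < β) : stableExponent C β 0 = 0 := by
  simp [stableExponent, hβ.ne']

theorem norm_stableExponent (ξ : ℝ) : ‖stableExponent C β ξ‖ = |C| * |ξ| ^ β := by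
  rw [stableExponent, Complex.norm_real, Real.norm_eq_abs, abs_mul, abs_neg,
    abs_of_nonneg (Real.rpow_nonneg (abs_nonneg ξ) β)]

/-- A nonnegative weight can be absorbed into the argument. This handles the masses of simple
functions, infinite divisibility and self-similarity. -/
theorem stableExponent_rpow_mul {v : ℝ} (hv : 0 ≤ v) (hβ : 0 < β) (ξ : ℝ) :
    stableExponent C β (v ^ (1 / β) * ξ) = v * stableExponent C β ξ := by
  simp only [stableExponent]
  rw [abs_mul, abs_of_nonneg (Real.rpow_nonneg hv _), Real.mul_rpow (Real.rpow_nonneg hv _)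
    (abs_nonneg _), ← Real.rpow_mul hv, one_div_mul_cancel hβ.ne', Real.rpow_one]
  push_cast
  ring

variable {X : Type*} [MeasurableSpace X] {m : Measure X}

theorem integrable_rpow_of_memLp {E : Type*} [NormedAddCommGroup E] {f : X → E} (hβ : 0 < β)
    (hf : MemLp f (ENNReal.ofReal β) m) : Integrable (fun x => ‖f x‖ ^ β) m := by
  have h := hf.integrable_norm_rpow (by simpa using hβ) ENNReal.ofReal_ne_top
  rwa [ENNReal.toReal_ofReal hβ.le] at h

variable {E : Type*} [NormedAddCommGroup E] [InnerProductSpace ℝ E] [FiniteDimensional ℝ E]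
  [MeasurableSpace E] [BorelSpace E]

/-- The integral is a finite sum over the values of `g`. Each mass is absorbed into its value, so
the exponential is a product of one-dimensional stable characteristic functions along fixed
directions. -/
theorem isCharFun_stable_simpleFunc (hβ : 0 < β)
    (h1 : IsCharFun fun ξ : ℝ => Complex.exp (stableExponent C β ξ))
    (g : SimpleFunc X E) (hg : Integrable g m) :
    IsCharFun fun t : E => Complex.exp (∫ x, stableExponent C β (inner ℝ (g x) t) ∂m) := by
  have key : ∀ t : E, ∫ x, stableExponent C β (inner ℝ (g x) t) ∂m
      = ∑ y ∈ g.range, stableExponent C β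
          (inner ℝ ((m.real (g ⁻¹' {y})) ^ (1 / β) • y) t) := fun t => by
    -- The value `0` may be taken on a set of infinite measure; it contributes nothing.
    have h0 : stableExponent C β (inner ℝ (0 : E) t) = 0 := by
      rw [inner_zero_left, stableExponent_zero hβ]
    have hint : Integrable (g.map fun y => stableExponent C β (inner ℝ y t)) m :=
      SimpleFunc.integrable_iff_finMeasSupp.2
        ((SimpleFunc.integrable_iff_finMeasSupp.1 hg).map h0)
    have h2 := SimpleFunc.integral_eq_integral _ hint
    rw [SimpleFunc.map_integral g _ hg h0] at h2
    rw [← show (∫ x, (g.map fun y => stableExponent C β (inner ℝ y t)) x ∂m)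
      = ∫ x, stableExponent C β (inner ℝ (g x) t) ∂m from rfl, ← h2]
    refine Finset.sum_congr rfl fun y _ => ?_
    rw [real_inner_smul_left, stableExponent_rpow_mul measureReal_nonneg hβ, Complex.real_smul]
  simp only [key, Complex.exp_sum]
  exact IsCharFun.prod _ fun y _ => h1.comp_inner _

theorem isCharFun_stable (hβ : 0 < β)
    (h1 : IsCharFun fun ξ : ℝ => Complex.exp (stableExponent C β ξ))
    {f : X → E} (hf : Measurable f) (hfβ : MemLp f (ENNReal.ofReal β) m) :
    IsCharFun fun t : E => Complex.exp (∫ x, stableExponent C β (inner ℝ (f x) t) ∂m) := by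
  have hint := integrable_rpow_of_memLp hβ hfβ
  have hcont := continuous_stableExponent (C := C) hβ
  -- The factor `2` is the bound for `approxOn`. `M = 1` serves continuity at `0`, `M = ‖t‖` the
  -- limit of the approximations. A pointwise bound also covers `β < 1`.
  have hbound : ∀ (y z t : E) (M : ℝ), ‖y‖ ≤ 2 * ‖z‖ → ‖t‖ ≤ M → 0 ≤ M →
      ‖stableExponent C β (inner ℝ y t)‖ ≤ |C| * ((2 * M) ^ β * ‖z‖ ^ β) := by
    intro y z t M hy ht hM
    rw [norm_stableExponent, ← Real.mul_rpow (by positivity) (norm_nonneg z)]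
    have h := abs_real_inner_le_norm y t
    gcongr
    nlinarith [norm_nonneg y, norm_nonneg z, norm_nonneg t,
      mul_le_mul hy ht (norm_nonneg t) (by positivity)]
  let g : ℕ → SimpleFunc X E := SimpleFunc.approxOn f hf Set.univ 0 (Set.mem_univ 0)
  have hg_lim : ∀ x, Tendsto (fun n => g n x) atTop (𝓝 (f x)) := fun x =>
    SimpleFunc.tendsto_approxOn hf (Set.mem_univ 0) (by simp)
  have hg_le : ∀ n x, ‖g n x‖ ≤ 2 * ‖f x‖ := fun n x => by
    have := SimpleFunc.norm_approxOn_zero_le hf (Set.mem_univ 0) x n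
    rw [two_mul]
    exact this
  -- For a simple function, `L^β` and `L¹` both amount to support of finite measure.
  have hg_int : ∀ n, Integrable (g n) m := fun n => by
    rw [← SimpleFunc.memLp_iff_integrable (p := ENNReal.ofReal β) (by simpa using hβ)
      ENNReal.ofReal_ne_top]
    refine MemLp.of_le (hfβ.const_smul (2 : ℝ)) (g n).aestronglyMeasurable
      (ae_of_all _ fun x => ?_)
    simpa [norm_smul] using hg_le n x
  refine IsCharFun.of_tendsto (fun n => isCharFun_stable_simpleFunc hβ h1 (g n) (hg_int n)) ?_ ?_
  · refine Complex.continuous_exp.continuousAt.comp ?_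
    refine continuousAt_of_dominated (bound := fun x => |C| * ((2 * 1) ^ β * ‖f x‖ ^ β))
      (Eventually.of_forall fun t => ?_) ?_ ((hint.const_mul _).const_mul _)
      (ae_of_all _ fun x => ?_)
    · exact (hcont.measurable.comp (hf.inner measurable_const)).aestronglyMeasurable
    · filter_upwards [Metric.ball_mem_nhds (0 : E) one_pos] with t ht
      refine ae_of_all _ fun x => hbound _ _ _ _ (by linarith [norm_nonneg (f x)]) ?_ zero_le_one
      simpa using (mem_ball_zero_iff.1 ht).le
    · exact (hcont.comp (by fun_prop)).continuousAt
  · intro t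
    refine (Complex.continuous_exp.tendsto _).comp ?_
    refine tendsto_integral_of_dominated_convergence
      (fun x => |C| * ((2 * ‖t‖) ^ β * ‖f x‖ ^ β)) (fun n => ?_)
      ((hint.const_mul _).const_mul _) (fun n => ae_of_all _ fun x => ?_)
      (ae_of_all _ fun x => ?_)
    · exact (hcont.measurable.comp ((g n).measurable.inner measurable_const)).aestronglyMeasurable
    · exact hbound _ _ _ _ (hg_le n x) le_rfl (norm_nonneg t)
    · exact (hcont.tendsto _).comp ((hg_lim x).inner tendsto_const_nhds)

end Stable

/-! ### Finite-dimensional laws and their characteristic functions -/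

section Marginals

theorem continuous_exp_sum {ι : Type*} [Fintype ι] (t : ι → ℝ) :
    Continuous fun x : ι → ℝ => Complex.exp (Complex.I * ((∑ i, t i * x i : ℝ) : ℂ)) := by
  refine Complex.continuous_exp.comp (continuous_const.mul (Complex.continuous_ofReal.comp ?_))
  exact continuous_finsetSum _ fun i _ => continuous_const.mul (continuous_apply i)

theorem ext_of_integral_exp {ι : Type*} [Fintype ι] {μ ν : Measure (ι → ℝ)} [IsFiniteMeasure μ]
    [IsFiniteMeasure ν]
    (h : ∀ t : ι → ℝ, ∫ x, Complex.exp (Complex.I * ((∑ i, t i * x i : ℝ) : ℂ)) ∂μ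
      = ∫ x, Complex.exp (Complex.I * ((∑ i, t i * x i : ℝ) : ℂ)) ∂ν) : μ = ν := by
  classical
  refine Measure.ext_of_charFunDual (funext fun L => ?_)
  have hL : ∀ x : ι → ℝ, L x = ∑ i, L (Pi.single i 1) * x i := fun x => by
    conv_lhs => rw [pi_eq_sum_univ' x, map_sum]
    refine Finset.sum_congr rfl fun i _ => ?_
    rw [map_smul, smul_eq_mul, mul_comm]
  simp only [charFunDual_apply]
  have := h fun i => L (Pi.single i 1)
  simp only [← hL] at this
  simpa only [mul_comm Complex.I] using this

variable {Ω : Type*} [MeasurableSpace Ω] {P : Measure Ω}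

theorem expectExp_congr {X : Ω →ₘ[P] ℝ} {Y : Ω → ℝ} (h : X =ᵐ[P] Y) :
    expectExp X = ∫ ω, Complex.exp (Complex.I * ((Y ω : ℝ) : ℂ)) ∂P :=
  integral_congr_ae (h.mono fun ω hω => by simp only [hω])

theorem expectExp_smul_eq_charFun [IsFiniteMeasure P] (X : Ω →ₘ[P] ℝ) (t : ℝ) :
    expectExp (t • X) = charFun (P.map X) t := by
  rw [expectExp_congr (AEEqFun.coeFn_smul t X), charFun_apply_real,
    integral_map X.aemeasurable (by fun_prop)]
  refine integral_congr_ae (ae_of_all _ fun ω => ?_)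
  simp only [Pi.smul_apply, smul_eq_mul, Complex.ofReal_mul]
  ring_nf

theorem eq_zero_of_expectExp_smul [IsProbabilityMeasure P] {X : Ω →ₘ[P] ℝ}
    (h : ∀ t : ℝ, expectExp (t • X) = 1) : X = 0 := by
  have hprob : IsProbabilityMeasure (P.map X) := Measure.isProbabilityMeasure_map X.aemeasurable
  have hdirac : P.map X = Measure.dirac 0 := by
    refine Measure.ext_of_charFun (funext fun t => ?_)
    rw [← expectExp_smul_eq_charFun, h t, charFun_dirac]
    simp
  have h0 : ∀ᵐ y ∂(P.map X), y = 0 := by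
    rw [hdirac, ae_dirac_eq]
    rfl
  refine AEEqFun.ext ?_
  filter_upwards [ae_of_ae_map X.aemeasurable h0,
    AEEqFun.coeFn_zero (μ := P) (β := ℝ) (α := Ω)] with ω hx hω
  rw [hx, hω]; rfl

end Marginals

/-! ### Construction of the stable random field -/

section StableField

variable {C β : ℝ} {X : Type*} [MeasurableSpace X] {m : Measure X}
  {V : Type*} [AddCommGroup V] [Module ℝ V] (F : V →ₗ[ℝ] (X →ₘ[m] ℝ))

theorem coeFn_finset_sum_smul {κ : Type*} (s : Finset κ) (f : κ → X →ₘ[m] ℝ) (c : κ → ℝ) :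
    ⇑(∑ k ∈ s, c k • f k) =ᵐ[m] fun x => ∑ k ∈ s, c k * f k x := by
  classical
  induction s using Finset.induction_on with
  | empty =>
    simp only [Finset.sum_empty]
    exact AEEqFun.coeFn_zero
  | insert a s ha ih =>
    simp only [Finset.sum_insert ha]
    filter_upwards [AEEqFun.coeFn_add (c a • f a) (∑ k ∈ s, c k • f k),
      AEEqFun.coeFn_smul (c a) (f a), ih] with x h1 h2 h3
    rw [h1, Pi.add_apply, h2, h3, Pi.smul_apply, smul_eq_mul]

theorem linearCombination_coeFn (c : V →₀ ℝ) :
    ⇑(F (Finsupp.linearCombination ℝ id c)) =ᵐ[m] fun x => ∑ u ∈ c.support, c u * F u x := by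
  rw [Finsupp.linearCombination_apply, Finsupp.sum, map_sum]
  simp only [map_smul, id]
  exact coeFn_finset_sum_smul _ _ _

/-- The finite-dimensional laws of the stable field with exponents `u ↦ -C ‖F u‖_β ^ β`. -/
theorem exists_stable_marginal (hβ : 0 < β)
    (h1 : IsCharFun fun ξ : ℝ => Complex.exp (stableExponent C β ξ))
    (hF : ∀ u, MemLp (F u) (ENNReal.ofReal β) m) (J : Finset V) :
    ∃ P : Measure (J → ℝ), IsProbabilityMeasure P ∧ ∀ t : J → ℝ,
      ∫ y, Complex.exp (Complex.I * ((∑ u, t u * y u : ℝ) : ℂ)) ∂P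
        = Complex.exp (∫ x, stableExponent C β (∑ u : J, t u * F u x) ∂m) := by
  classical
  let f : X → EuclideanSpace ℝ J := fun x => WithLp.toLp 2 fun u : J => F u x
  have hf : Measurable f :=
    (WithLp.measurable_toLp 2 (J → ℝ)).comp
      (measurable_pi_lambda _ fun u => (F u).measurable)
  have hfβ : MemLp f (ENNReal.ofReal β) m := by
    have hsum : f = fun x => ∑ u : J, F u x • EuclideanSpace.single u (1 : ℝ) := by
      ext x v
      simp [f, Finset.sum_apply, Pi.single_apply]
    rw [hsum]
    refine memLp_finsetSum _ fun u _ => ?_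
    refine MemLp.of_le (hF u) ((F u).aestronglyMeasurable.smul_const _) (ae_of_all _ fun x => ?_)
    simp [norm_smul]
  obtain ⟨Q, hQ, hQc⟩ := isCharFun_stable hβ h1 hf hfβ
  have hm : Measurable (WithLp.ofLp : EuclideanSpace ℝ J → J → ℝ) := WithLp.measurable_ofLp 2 _
  refine ⟨Q.map WithLp.ofLp, Measure.isProbabilityMeasure_map hm.aemeasurable, fun t => ?_⟩
  rw [integral_map hm.aemeasurable (continuous_exp_sum _).aestronglyMeasurable]
  have := hQc (WithLp.toLp 2 t)
  rw [charFun_apply] at this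
  simp only [PiLp.inner_apply, f, RCLike.inner_apply, conj_trivial] at this
  simpa only [mul_comm Complex.I] using this

/-- The vectors of `V` serve only as labels of coordinates here. Formal combinations `c : V →₀ ℝ`
record the joint laws; linear relations in `V` enter only through `F`. -/
theorem exists_stable_coordinates (hβ : 0 < β)
    (h1 : IsCharFun fun ξ : ℝ => Complex.exp (stableExponent C β ξ))
    (hF : ∀ u, MemLp (F u) (ENNReal.ofReal β) m) :
    ∃ P : Measure (V → ℝ), IsProbabilityMeasure P ∧ ∀ c : V →₀ ℝ,
      ∫ ω, Complex.exp (Complex.I * ((Finsupp.linearCombination ℝ ω c : ℝ) : ℂ)) ∂P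
        = Complex.exp (∫ x, stableExponent C β (F (Finsupp.linearCombination ℝ id c) x) ∂m) := by
  classical
  choose P hP hPc using exists_stable_marginal F hβ h1 hF
  have hproj : IsProjectiveMeasureFamily (α := fun _ : V => ℝ) P := by
    intro I J hJI
    have hm : Measurable (Finset.restrict₂ (π := fun _ : V => ℝ) hJI) :=
      Finset.measurable_restrict₂ hJI
    have : IsProbabilityMeasure ((P I).map (Finset.restrict₂ (π := fun _ : V => ℝ) hJI)) :=
      Measure.isProbabilityMeasure_map hm.aemeasurable
    refine ext_of_integral_exp fun t => ?_
    rw [integral_map hm.aemeasurable (continuous_exp_sum _).aestronglyMeasurable]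
    -- Marginalizing to `J` amounts to extending the frequency by zero from `J` to `I`.
    let t' : I → ℝ := fun u => if h : (u : V) ∈ J then t ⟨u, h⟩ else 0
    have hsum : ∀ y : V → ℝ, ∑ u : I, t' u * y u = ∑ u : J, t u * y u := by
      intro y
      have e1 : ∑ u : I, t' u * y u
          = ∑ u ∈ I, (if h : u ∈ J then t ⟨u, h⟩ else 0) * y u :=
        Finset.sum_coe_sort I fun u => (if h : u ∈ J then t ⟨u, h⟩ else 0) * y u
      have e2 : ∑ u : J, t u * y u
          = ∑ u ∈ J, (if h : u ∈ J then t ⟨u, h⟩ else 0) * y u := by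
        rw [← Finset.sum_coe_sort J]
        exact Finset.sum_congr rfl fun u _ => by simp
      rw [e1, e2]
      exact (Finset.sum_subset hJI fun u _ hu => by simp [hu]).symm
    have hsum' : ∀ y : I → ℝ,
        ∑ u : J, t u * Finset.restrict₂ (π := fun _ : V => ℝ) hJI y u = ∑ u : I, t' u * y u := by
      intro y
      have := hsum fun u => if h : u ∈ I then y ⟨u, h⟩ else 0
      simp only [Finset.coe_mem, dite_true, Subtype.coe_eta] at this
      rw [this]
      exact Finset.sum_congr rfl fun u _ => by simp [hJI u.2]
    have e : ∀ x, ∑ u : I, t' u * F u x = ∑ u : J, t u * F u x := fun x => hsum fun u => F u x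
    simp only [hsum', hPc, e]
  obtain ⟨μ, hμ⟩ := exists_isProjectiveLimit hproj
  have hμp : IsProbabilityMeasure μ := hμ.isProbabilityMeasure
  refine ⟨μ, hμp, fun c => ?_⟩
  have hm : Measurable (Finset.restrict (π := fun _ : V => ℝ) c.support) :=
    Finset.measurable_restrict _
  have h2 := hPc c.support fun u => c u
  rw [← hμ c.support, integral_map hm.aemeasurable
    (continuous_exp_sum fun u : c.support => c u).aestronglyMeasurable] at h2
  have e1 : ∀ y : V → ℝ, ∑ u : c.support, c u * y u = ∑ u ∈ c.support, c u * y u := fun y =>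
    Finset.sum_coe_sort c.support fun u => c u * y u
  have e2 : ∀ x, ∑ u : c.support, c u * F u x = ∑ u ∈ c.support, c u * F u x := fun x =>
    e1 fun u => F u x
  simp only [Finset.restrict_def, e1, e2] at h2
  simp only [Finsupp.linearCombination_apply, Finsupp.sum, smul_eq_mul]
  rw [h2]
  congr 1
  refine integral_congr_ae ((linearCombination_coeFn F c).mono fun x hx => ?_)
  simp only [Finsupp.linearCombination_apply, Finsupp.sum] at hx
  simp only [hx]

/-- The stable integral: a linear field with characteristic functional
`u ↦ exp (-C ‖F u‖_β ^ β)`. -/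
theorem exists_stable_field {V : Type} [AddCommGroup V] [Module ℝ V]
    (F : V →ₗ[ℝ] (X →ₘ[m] ℝ)) (hβ : 0 < β)
    (h1 : IsCharFun fun ξ : ℝ => Complex.exp (stableExponent C β ξ))
    (hF : ∀ u, MemLp (F u) (ENNReal.ofReal β) m) :
    ∃ (Ω : Type) (_ : MeasurableSpace Ω) (P : Measure Ω) (_ : IsProbabilityMeasure P)
      (S : V →ₗ[ℝ] (Ω →ₘ[P] ℝ)), ∀ u : V,
      expectExp (S u) = Complex.exp (∫ x, stableExponent C β (F u x) ∂m) := by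
  obtain ⟨P, hP, hPc⟩ := exists_stable_coordinates F hβ h1 hF
  have hmeas : ∀ u : V, AEStronglyMeasurable (fun ω : V → ℝ => ω u) P := fun u =>
    (measurable_pi_apply u).aestronglyMeasurable
  let S : V → ((V → ℝ) →ₘ[P] ℝ) := fun u => AEEqFun.mk _ (hmeas u)
  have hS : ∀ c : V →₀ ℝ, ⇑(Finsupp.linearCombination ℝ S c)
      =ᵐ[P] fun ω => Finsupp.linearCombination ℝ ω c := fun c => by
    simp only [Finsupp.linearCombination_apply, Finsupp.sum, smul_eq_mul]
    refine (coeFn_finset_sum_smul _ _ _).trans ?_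
    have : ∀ᵐ ω ∂P, ∀ u ∈ c.support, S u ω = ω u :=
      (ae_ball_iff c.support.countable_toSet).2 fun u _ => AEEqFun.coeFn_mk _ (hmeas u)
    filter_upwards [this] with ω hω
    exact Finset.sum_congr rfl fun u hu => by rw [hω u hu]
  have hchar : ∀ c : V →₀ ℝ, expectExp (Finsupp.linearCombination ℝ S c)
      = Complex.exp (∫ x, stableExponent C β (F (Finsupp.linearCombination ℝ id c) x) ∂m) :=
    fun c => by rw [expectExp_congr (hS c), hPc]
  -- Linear relations in `V` hold almost surely for the coordinates, because every multiple of such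
  -- a combination has characteristic value `1`. Applied below to the relations defining sums and
  -- scalar multiples.
  have hzero : ∀ c : V →₀ ℝ, Finsupp.linearCombination ℝ id c = 0 →
      Finsupp.linearCombination ℝ S c = 0 := fun c hc => by
    refine eq_zero_of_expectExp_smul fun t => ?_
    rw [← map_smul, hchar, map_smul, hc, smul_zero, map_zero, integral_eq_zero_of_ae,
      Complex.exp_zero]
    filter_upwards [AEEqFun.coeFn_zero (μ := m) (β := ℝ) (α := X)] with x hx
    rw [hx]
    exact stableExponent_zero hβ
  refine ⟨V → ℝ, inferInstance, P, hP,
    { toFun := S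
      map_add' := fun u v => ?_
      map_smul' := fun a u => ?_ }, fun u => ?_⟩
  · have := hzero (Finsupp.single (u + v) 1 - (Finsupp.single u 1 + Finsupp.single v 1))
      (by simp)
    simpa [sub_eq_zero] using this
  · have := hzero (Finsupp.single (a • u) 1 - Finsupp.single u a) (by simp)
    simpa [sub_eq_zero] using this
  · simpa using hchar (Finsupp.single u 1)

end StableField

/-! ### Growth of Lévy exponents and the scaling limit of their integrals -/

section LevyExponent

variable {Ψ : ℝ → ℂ} {C β : ℝ}

theorem norm_exp_mul_I_sub_one_le_rpow {ε : ℝ} (hε : 0 < ε) (hε1 : ε ≤ 1) (y : ℝ) :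
    ‖Complex.exp (y * Complex.I) - 1‖ ≤ 2 * |y| ^ ε := by
  rcases le_or_gt |y| 1 with hy | hy
  · have h1 : ‖Complex.exp (y * Complex.I) - 1‖ ≤ |y| := by
      rw [mul_comm]
      exact Real.norm_exp_I_mul_ofReal_sub_one_le
    have h2 : |y| ≤ |y| ^ ε := by
      conv_lhs => rw [← Real.rpow_one |y|]
      exact Real.rpow_le_rpow_of_exponent_ge_of_imp (abs_nonneg y) hy hε1 fun _ h => by
        exact absurd h one_ne_zero
    linarith [Real.rpow_nonneg (abs_nonneg y) ε]
  · have h1 : ‖Complex.exp (y * Complex.I) - 1‖ ≤ 2 := by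
      refine (norm_sub_le _ _).trans ?_
      rw [Complex.norm_exp_ofReal_mul_I, norm_one]
      norm_num
    have h2 : 1 ≤ |y| ^ ε := Real.one_le_rpow hy.le hε.le
    linarith

theorem norm_charFun_sub_one_le {μ : Measure ℝ} [IsProbabilityMeasure μ] {ε : ℝ} (hε : 0 < ε)
    (hε1 : ε ≤ 1) (hint : Integrable (fun x : ℝ => |x| ^ ε) μ) (ξ : ℝ) :
    ‖charFun μ ξ - 1‖ ≤ 2 * (∫ x, |x| ^ ε ∂μ) * |ξ| ^ ε := by
  have hexp : Integrable (fun x : ℝ => Complex.exp (ξ * x * Complex.I)) μ := by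
    refine Integrable.of_bound (by fun_prop) 1 (ae_of_all _ fun x => ?_)
    rw [← Complex.ofReal_mul, Complex.norm_exp_ofReal_mul_I]
  have h1 : charFun μ ξ - 1 = ∫ x : ℝ, (Complex.exp (ξ * x * Complex.I) - 1) ∂μ := by
    rw [integral_sub hexp (integrable_const _), charFun_apply_real]
    simp
  rw [h1, mul_assoc, mul_comm (∫ x, |x| ^ ε ∂μ), ← mul_assoc, ← integral_const_mul]
  refine norm_integral_le_of_norm_le (hint.const_mul _) (ae_of_all _ fun x => ?_)
  have := norm_exp_mul_I_sub_one_le_rpow hε hε1 (ξ * x)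
  rw [abs_mul, Real.mul_rpow (abs_nonneg _) (abs_nonneg _), ← mul_assoc] at this
  rwa [← Complex.ofReal_mul]

/-- The remainder of the exponential is at most `‖z‖² ≤ ‖z‖ / 2`. This carries bounds on `exp Ψ - 1`
over to `Ψ` near the origin, where `Ψ` is small. -/
theorem norm_le_two_mul_norm_exp_sub_one {z : ℂ} (hz : ‖z‖ ≤ 1 / 2) :
    ‖z‖ ≤ 2 * ‖Complex.exp z - 1‖ := by
  have h1 := Complex.norm_exp_sub_one_sub_id_le (x := z) (by linarith)
  have h2 : ‖z‖ ≤ ‖Complex.exp z - 1‖ + ‖Complex.exp z - 1 - z‖ := by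
    calc ‖z‖ = ‖(Complex.exp z - 1) - (Complex.exp z - 1 - z)‖ := by congr 1; ring
      _ ≤ _ := norm_sub_le _ _
  nlinarith [norm_nonneg z]

/-- A tempered Lévy exponent is bounded by a power near the origin. -/
theorem IsTemperedLevyExponent.exists_local_bound (h : IsTemperedLevyExponent Ψ) (hβ : 0 < β) :
    ∃ ε K δ : ℝ, 0 < ε ∧ ε ≤ β ∧ 0 ≤ K ∧ 0 < δ ∧ ∀ ξ : ℝ, |ξ| < δ → ‖Ψ ξ‖ ≤ K * |ξ| ^ ε := by
  obtain ⟨hcont, h0, μ, hμ, -, hchar, ε₀, hε₀, hint₀⟩ := h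
  -- At most `ε₀` for the moment, at most `1` to interpolate `‖exp(iy) - 1‖` between `|y|` and `2`,
  -- at most `β` for the later domination.
  let ε := min ε₀ (min 1 β)
  have hε : 0 < ε := by positivity
  have hε1 : ε ≤ 1 := (min_le_right _ _).trans (min_le_left _ _)
  have hint : Integrable (fun x : ℝ => |x| ^ ε) μ := by
    refine Integrable.mono' ((integrable_const (1 : ℝ)).add hint₀)
      (continuous_abs.rpow_const fun _ => Or.inr hε.le).aestronglyMeasurable
      (ae_of_all _ fun x => ?_)
    rw [Real.norm_of_nonneg (Real.rpow_nonneg (abs_nonneg x) _), Pi.add_apply]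
    rcases le_total |x| 1 with hx | hx
    · linarith [Real.rpow_le_one (abs_nonneg x) hx hε.le, Real.rpow_nonneg (abs_nonneg x) ε₀]
    · linarith [Real.rpow_le_rpow_of_exponent_le hx (min_le_left ε₀ (min 1 β))]
  have hnear : ∀ᶠ ξ in 𝓝 (0 : ℝ), ‖Ψ ξ‖ < 1 / 2 := by
    have : Tendsto (fun ξ => ‖Ψ ξ‖) (𝓝 0) (𝓝 0) := by
      simpa [h0] using (hcont.tendsto 0).norm
    exact this.eventually_lt_const (by norm_num)
  obtain ⟨δ, hδ, hball⟩ := Metric.eventually_nhds_iff.1 hnear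
  refine ⟨ε, 4 * ∫ x, |x| ^ ε ∂μ, δ, hε, (min_le_right _ _).trans (min_le_right _ _),
    mul_nonneg (by norm_num) (integral_nonneg fun x => Real.rpow_nonneg (abs_nonneg x) _), hδ,
    fun ξ hξ => ?_⟩
  have h1 := norm_le_two_mul_norm_exp_sub_one (hball (y := ξ) (by simpa using hξ)).le
  rw [← hchar] at h1
  linarith [norm_charFun_sub_one_le hε hε1 hint ξ]

theorem IsTemperedLevyExponent.exists_bound (h : IsTemperedLevyExponent Ψ) (hβ : 0 < β)
    (hΨ : Asymptotics.IsEquivalent (Bornology.cobounded ℝ) Ψ (stableExponent C β)) :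
    ∃ ε K : ℝ, 0 < ε ∧ ε ≤ β ∧ ∀ ξ : ℝ, ‖Ψ ξ‖ ≤ K * (|ξ| ^ ε + |ξ| ^ β) := by
  obtain ⟨ε, K, δ, hε, hεβ, hK, hδ, hloc⟩ := h.exists_local_bound hβ
  obtain ⟨c, hc, hbig⟩ := hΨ.isBigO.exists_pos
  rw [Asymptotics.isBigOWith_iff, (Metric.hasBasis_cobounded_compl_closedBall 0).eventually_iff]
    at hbig
  obtain ⟨R, -, hR⟩ := hbig
  obtain ⟨B, hB⟩ := (isCompact_closedBall (0 : ℝ) R).exists_bound_of_continuousOn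
    h.1.continuousOn
  -- One summand per zone: near `0` the moment bound, on `δ ≤ |ξ| ≤ R` compactness, beyond `R` the
  -- equivalence at infinity.
  refine ⟨ε, K + |B| / δ ^ ε + c * |C|, hε, hεβ, fun ξ => ?_⟩
  have hξε := Real.rpow_nonneg (abs_nonneg ξ) ε
  have hξβ := Real.rpow_nonneg (abs_nonneg ξ) β
  have hδε := Real.rpow_pos_of_pos hδ ε
  have hp1 : 0 ≤ |B| / δ ^ ε := by positivity
  have hp2 : 0 ≤ c * |C| := by positivity
  by_cases hξ : |ξ| < δ
  · refine (hloc ξ hξ).trans ?_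
    gcongr ?_ * ?_ <;> linarith
  by_cases hξR : ξ ∈ Metric.closedBall (0 : ℝ) R
  · have h1 : ‖Ψ ξ‖ ≤ |B| := (hB ξ hξR).trans (le_abs_self B)
    have h2 : |B| ≤ |B| / δ ^ ε * |ξ| ^ ε := by
      rw [div_mul_eq_mul_div, le_div_iff₀ hδε]
      gcongr
      exact not_lt.1 hξ
    refine h1.trans (h2.trans ?_)
    gcongr ?_ * ?_ <;> linarith
  · have h1 := hR hξR
    rw [norm_stableExponent, ← mul_assoc] at h1
    refine h1.trans ?_
    gcongr ?_ * ?_ <;> linarith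

theorem tendsto_inv_mul_comp_rpow_mul (hβ : 0 < β) (h0 : Ψ 0 = 0)
    (hΨ : Asymptotics.IsEquivalent (Bornology.cobounded ℝ) Ψ (stableExponent C β)) (ξ : ℝ) :
    Tendsto (fun v : ℝ => ((v⁻¹ : ℝ) : ℂ) * Ψ (v ^ (1 / β) * ξ)) atTop
      (𝓝 (stableExponent C β ξ)) := by
  rcases eq_or_ne ξ 0 with rfl | hξ
  · simp [h0, stableExponent_zero hβ]
  obtain ⟨u, hu, hu'⟩ := hΨ.exists_eq_mul
  have hk : Tendsto (fun v : ℝ => v ^ (1 / β) * ξ) atTop (Bornology.cobounded ℝ) := by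
    rw [← tendsto_norm_atTop_iff_cobounded]
    have : Tendsto (fun v : ℝ => v ^ (1 / β) * |ξ|) atTop atTop :=
      (tendsto_rpow_atTop (by positivity)).atTop_mul_const (abs_pos.2 hξ)
    refine this.congr' ?_
    filter_upwards [eventually_ge_atTop 0] with v hv
    rw [norm_mul, Real.norm_of_nonneg (Real.rpow_nonneg hv _), Real.norm_eq_abs]
  have h1 : Tendsto (fun v : ℝ => u (v ^ (1 / β) * ξ) * stableExponent C β ξ) atTop
      (𝓝 (1 * stableExponent C β ξ)) := (hu.comp hk).mul_const _
  rw [one_mul] at h1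
  refine h1.congr' ?_
  filter_upwards [hk.eventually hu', eventually_gt_atTop 0] with v hv hv0
  rw [hv, Pi.mul_apply, stableExponent_rpow_mul hv0.le hβ]
  have : (v : ℂ) ≠ 0 := Complex.ofReal_ne_zero.2 hv0.ne'
  push_cast
  field_simp

theorem tendsto_integral_inv_mul_comp {X : Type*} [MeasurableSpace X] {m : Measure X}
    {f : X → ℝ} {ε K : ℝ} (hβ : 0 < β) (hε : 0 < ε) (hεβ : ε ≤ β) (hcont : Continuous Ψ)
    (h0 : Ψ 0 = 0)
    (hK : ∀ ξ : ℝ, ‖Ψ ξ‖ ≤ K * (|ξ| ^ ε + |ξ| ^ β))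
    (hΨ : Asymptotics.IsEquivalent (Bornology.cobounded ℝ) Ψ (stableExponent C β))
    (hf : AEStronglyMeasurable f m) (hfε : Integrable (fun x => ‖f x‖ ^ ε) m)
    (hfβ : Integrable (fun x => ‖f x‖ ^ β) m) :
    Tendsto (fun v : ℝ => ∫ x, ((v⁻¹ : ℝ) : ℂ) * Ψ (v ^ (1 / β) * f x) ∂m) atTop
      (𝓝 (∫ x, stableExponent C β (f x) ∂m)) := by
  have hK0 : 0 ≤ K := by
    have := (norm_nonneg _).trans (hK 1)
    simp only [abs_one, Real.one_rpow] at this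
    linarith
  refine tendsto_integral_filter_of_dominated_convergence
    (fun x => K * (‖f x‖ ^ ε + ‖f x‖ ^ β)) (Eventually.of_forall fun v => ?_) ?_
    ((hfε.add hfβ).const_mul K)
    (ae_of_all _ fun x => tendsto_inv_mul_comp_rpow_mul hβ h0 hΨ (f x))
  · exact (hcont.comp_aestronglyMeasurable (hf.const_mul _)).const_mul _
  · filter_upwards [eventually_ge_atTop 1] with v hv
    refine ae_of_all _ fun x => ?_
    have hv0 : 0 < v := by linarith
    rw [norm_mul, Complex.norm_real, Real.norm_of_nonneg (inv_nonneg.2 hv0.le),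
      inv_mul_le_iff₀ hv0]
    refine (hK _).trans ?_
    -- Since `v ≥ 1` and `p ≤ β`, `v^(p/β) ≤ v`, which the prefactor `v⁻¹` cancels.
    have hp : ∀ p : ℝ, 0 < p → p ≤ β →
        |v ^ (1 / β) * f x| ^ p ≤ v * ‖f x‖ ^ p := fun p hp hpβ => by
      rw [abs_mul, abs_of_nonneg (Real.rpow_nonneg hv0.le _),
        Real.mul_rpow (Real.rpow_nonneg hv0.le _) (abs_nonneg _), ← Real.rpow_mul hv0.le,
        Real.norm_eq_abs]
      gcongr
      conv_rhs => rw [← Real.rpow_one v]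
      refine Real.rpow_le_rpow_of_exponent_le hv ?_
      rw [one_div_mul_eq_div, div_le_one hβ]
      exact hpβ
    calc K * (|v ^ (1 / β) * f x| ^ ε + |v ^ (1 / β) * f x| ^ β)
        ≤ K * (v * ‖f x‖ ^ ε + v * ‖f x‖ ^ β) := by
          gcongr
          · exact hp ε hε hεβ
          · exact hp β hβ le_rfl
      _ = v * (K * (‖f x‖ ^ ε + ‖f x‖ ^ β)) := by ring

end LevyExponent

/-! ### Laws and convergence of generalized processes -/

section ProcessLaws

variable {Ω : Type*} [MeasurableSpace Ω] {P : Measure Ω}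
  {Ω' : Type*} [MeasurableSpace Ω'] {P' : Measure Ω'}

theorem integral_exp_marginal {V : Type*} [AddCommGroup V] [Module ℝ V]
    (S : V →ₗ[ℝ] (Ω →ₘ[P] ℝ)) {N : ℕ} (u : Fin N → V) (t : Fin N → ℝ) :
    ∫ y, Complex.exp (Complex.I * ((∑ i, t i * y i : ℝ) : ℂ)) ∂(P.map fun ω i => S (u i) ω)
      = expectExp (S (∑ i, t i • u i)) := by
  have hm : AEMeasurable (fun ω i => S (u i) ω) P :=
    (measurable_pi_lambda _ fun i => (S (u i)).measurable).aemeasurable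
  rw [integral_map hm (continuous_exp_sum t).aestronglyMeasurable, map_sum]
  simp only [map_smul]
  rw [expectExp_congr (coeFn_finset_sum_smul Finset.univ (fun i => S (u i)) t)]

variable {d : ℕ}

theorem equalInLaw_of_charFunctional_eq [IsFiniteMeasure P] [IsFiniteMeasure P']
    {s : GenProcess d P} {s' : GenProcess d P'}
    (h : ∀ φ, charFunctional s φ = charFunctional s' φ) : EqualInLaw s s' := fun N φ => by
  have hm : Measurable fun ω i => s.toLin (φ i) ω :=
    measurable_pi_lambda _ fun i => (s.toLin (φ i)).measurable
  have hm' : Measurable fun ω i => s'.toLin (φ i) ω :=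
    measurable_pi_lambda _ fun i => (s'.toLin (φ i)).measurable
  refine ⟨hm.aemeasurable, hm'.aemeasurable, ext_of_integral_exp fun t => ?_⟩
  rw [integral_exp_marginal, integral_exp_marginal]
  exact h _

/-- **Lévy's continuity theorem** for generalized random processes. -/
theorem convergesInLaw_of_tendsto_charFunctional [IsProbabilityMeasure P]
    [IsProbabilityMeasure P'] {s : ℝ → GenProcess d P} {s' : GenProcess d P'} {l : Filter ℝ}
    [l.IsCountablyGenerated]
    (h : ∀ φ, Tendsto (fun a => charFunctional (s a) φ) l (𝓝 (charFunctional s' φ))) :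
    ConvergesInLaw s l s' := fun N φ => by
  have hm : ∀ a, Measurable fun ω i => (s a).toLin (φ i) ω := fun a =>
    measurable_pi_lambda _ fun i => ((s a).toLin (φ i)).measurable
  have hm' : Measurable fun ω i => s'.toLin (φ i) ω :=
    measurable_pi_lambda _ fun i => (s'.toLin (φ i)).measurable
  have hL : Measurable (WithLp.toLp 2 : (Fin N → ℝ) → EuclideanSpace ℝ (Fin N)) :=
    WithLp.measurable_toLp 2 _
  have hchar : ∀ (ν : Measure (Fin N → ℝ)) (t : EuclideanSpace ℝ (Fin N)),
      charFun (ν.map (WithLp.toLp 2)) t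
        = ∫ y, Complex.exp (Complex.I * ((∑ i, t i * y i : ℝ) : ℂ)) ∂ν := fun ν t => by
    rw [charFun_apply, integral_map hL.aemeasurable (by fun_prop)]
    simp only [PiLp.inner_apply, RCLike.inner_apply, conj_trivial, mul_comm Complex.I]
  -- The continuity theorem lives on an inner product space, so the marginals are moved to
  -- `EuclideanSpace` and brought back by continuous mapping.
  have key : TendstoInDistribution
      (fun a ω => (WithLp.toLp 2 fun i => (s a).toLin (φ i) ω : EuclideanSpace ℝ (Fin N))) l
      (fun ω => WithLp.toLp 2 fun i => s'.toLin (φ i) ω) (fun _ => P) P' := by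
    refine ⟨fun a => (hL.comp (hm a)).aemeasurable, (hL.comp hm').aemeasurable, ?_⟩
    refine tendsto_of_seq_tendsto fun a ha => ?_
    refine ProbabilityMeasure.tendsto_of_tendsto_charFun fun t => ?_
    have e : ∀ b, charFun (P.map fun ω =>
        (WithLp.toLp 2 fun i => (s b).toLin (φ i) ω : EuclideanSpace ℝ (Fin N))) t
          = charFunctional (s b) (∑ i, t i • φ i) := fun b => by
      change charFun (P.map (WithLp.toLp 2 ∘ fun ω i => (s b).toLin (φ i) ω)) t = _
      rw [← Measure.map_map hL (hm b), hchar, integral_exp_marginal]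
      rfl
    have e' : charFun (P'.map fun ω =>
        (WithLp.toLp 2 fun i => s'.toLin (φ i) ω : EuclideanSpace ℝ (Fin N))) t
          = charFunctional s' (∑ i, t i • φ i) := by
      change charFun (P'.map (WithLp.toLp 2 ∘ fun ω i => s'.toLin (φ i) ω)) t = _
      rw [← Measure.map_map hL hm', hchar, integral_exp_marginal]
      rfl
    have := (h (∑ i, t i • φ i)).comp ha
    rw [← e'] at this
    refine this.congr fun n => ?_
    exact (e (a n)).symm
  exact key.continuous_comp (PiLp.continuous_ofLp 2 fun _ : Fin N => ℝ)

/-- The tail of `X n - X₀` is controlled by the average of `1 - charFun` over a bounded interval,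
which tends to `0` by dominated convergence. -/
theorem tendstoInMeasure_of_tendsto_expectExp [IsProbabilityMeasure P] {X : ℕ → (Ω →ₘ[P] ℝ)}
    {X₀ : Ω →ₘ[P] ℝ}
    (h : ∀ t : ℝ, Tendsto (fun n => expectExp (t • (X n - X₀))) atTop (𝓝 1)) :
    TendstoInMeasure P (fun n => (X n : Ω → ℝ)) atTop (X₀ : Ω → ℝ) := by
  rw [tendstoInMeasure_iff_measureReal_norm]
  intro r hr
  let μ : ℕ → Measure ℝ := fun n => P.map (X n - X₀ : Ω →ₘ[P] ℝ)
  have hμ : ∀ n, IsProbabilityMeasure (μ n) := fun n =>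
    Measure.isProbabilityMeasure_map (X n - X₀ : Ω →ₘ[P] ℝ).aemeasurable
  have hchar : ∀ t, Tendsto (fun n => charFun (μ n) t) atTop (𝓝 1) := fun t =>
    (h t).congr fun n => expectExp_smul_eq_charFun _ t
  -- The tail estimate concerns a strict inequality, the goal `r ≤ |·|`; halving `r` bridges the
  -- two.
  have hr2 : 0 < r / 2 := by linarith
  have hlim : Tendsto (fun n => 2⁻¹ * (r / 2) *
      ‖∫ t in (-2 * (r / 2)⁻¹)..(2 * (r / 2)⁻¹), 1 - charFun (μ n) t‖) atTop (𝓝 0) := by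
    have : Tendsto (fun n => ∫ t in (-2 * (r / 2)⁻¹)..(2 * (r / 2)⁻¹), 1 - charFun (μ n) t)
        atTop (𝓝 (∫ t in (-2 * (r / 2)⁻¹)..(2 * (r / 2)⁻¹), (1 - 1 : ℂ))) := by
      refine intervalIntegral.tendsto_integral_filter_of_dominated_convergence (fun _ => 2)
        (Eventually.of_forall fun n => ?_) (Eventually.of_forall fun n => ?_) (by simp) ?_
      · exact (measurable_const.sub measurable_charFun).aestronglyMeasurable
      · exact ae_of_all _ fun t _ => norm_one_sub_charFun_le_two
      · exact ae_of_all _ fun t _ => tendsto_const_nhds.sub (hchar t)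
    simpa using (this.norm.const_mul (2⁻¹ * (r / 2)))
  refine squeeze_zero (fun n => measureReal_nonneg) (fun n => ?_) hlim
  refine le_trans ?_ (measureReal_abs_gt_le_integral_charFun (μ := μ n) hr2)
  have hms : MeasurableSet {x : ℝ | r / 2 < |x|} :=
    measurableSet_lt measurable_const continuous_abs.measurable
  rw [map_measureReal_apply_of_aemeasurable (X n - X₀ : Ω →ₘ[P] ℝ).aemeasurable hms]
  refine ENNReal.toReal_mono (measure_ne_top _ _) (measure_mono_ae ?_)
  filter_upwards [AEEqFun.coeFn_sub (X n) X₀] with ω hω hle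
  change r / 2 < |(X n - X₀ : Ω →ₘ[P] ℝ) ω|
  rw [hω]
  have : r ≤ |X n ω - X₀ ω| := hle
  simp only [Pi.sub_apply]
  linarith

end ProcessLaws

/-! ### The stable exponent is a tempered Lévy exponent -/

section Tempered

variable {C β : ℝ}

theorem charFun_map_sum_pi {ν : Measure ℝ} [IsProbabilityMeasure ν] (N : ℕ) (t : ℝ) :
    charFun ((Measure.pi fun _ : Fin N => ν).map fun x => ∑ i, x i) t = charFun ν t ^ N := by
  rw [charFun_apply_real, integral_map (by fun_prop) (by fun_prop), charFun_apply_real]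
  have : ∀ x : Fin N → ℝ, Complex.exp (t * ((∑ i, x i : ℝ) : ℂ) * Complex.I)
      = ∏ i, Complex.exp (t * (x i : ℂ) * Complex.I) := fun x => by
    rw [← Complex.exp_sum]
    push_cast
    rw [Finset.mul_sum, Finset.sum_mul]
  simp only [this]
  rw [integral_fintype_prod_eq_prod (fun _ : Fin N => fun y : ℝ => Complex.exp (t * y * Complex.I))]
  simp

/-- Layer-cake formula: tails are at most `1` on `(0, 1]`, and beyond `1` the integrand is `O(t^(ε -
1 - β))`, integrable since `ε < β`. -/
theorem integrable_rpow_of_measureReal_le {μ : Measure ℝ} [IsProbabilityMeasure μ] {D ε : ℝ}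
    (hε : 0 < ε) (hεβ : ε < β) (h : ∀ r : ℝ, 0 < r → μ.real {x | r < |x|} ≤ D * r ^ (-β)) :
    Integrable (fun x : ℝ => |x| ^ ε) μ := by
  have hmeas : Measurable fun x : ℝ => |x| ^ ε :=
    (continuous_abs.rpow_const fun _ => Or.inr hε.le).measurable
  refine ⟨hmeas.aestronglyMeasurable, ?_⟩
  rw [hasFiniteIntegral_iff_ofReal (ae_of_all _ fun x => Real.rpow_nonneg (abs_nonneg x) _)]
  rw [lintegral_rpow_eq_lintegral_meas_lt_mul μ (ae_of_all _ fun x => abs_nonneg x)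
    continuous_abs.aemeasurable hε]
  refine ENNReal.mul_lt_top ENNReal.ofReal_lt_top ?_
  have hsplit : Set.Ioi (0 : ℝ) = Set.Ioc 0 1 ∪ Set.Ioi 1 :=
    (Set.Ioc_union_Ioi_eq_Ioi zero_le_one).symm
  rw [hsplit]
  refine (lintegral_union_le _ _ _).trans_lt (ENNReal.add_lt_top.2 ⟨?_, ?_⟩)
  · have hint : IntegrableOn (fun t : ℝ => t ^ (ε - 1)) (Set.Ioc 0 1) :=
      (intervalIntegrable_iff_integrableOn_Ioc_of_le zero_le_one).1
        (intervalIntegral.intervalIntegrable_rpow' (by linarith))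
    refine lt_of_le_of_lt ?_ hint.lintegral_lt_top
    refine lintegral_mono fun t => ?_
    calc _ ≤ 1 * ENNReal.ofReal (t ^ (ε - 1)) := by gcongr; exact prob_le_one
      _ = _ := one_mul _
  · have hint : IntegrableOn (fun t : ℝ => D * t ^ (ε - 1 - β)) (Set.Ioi 1) :=
      (integrableOn_Ioi_rpow_of_lt (by linarith) one_pos).const_mul D
    refine lt_of_le_of_lt ?_ hint.lintegral_lt_top
    refine setLIntegral_mono' measurableSet_Ioi fun t ht => ?_
    have ht0 : 0 < t := one_pos.trans ht
    have h1 : μ {x | t < |x|} ≤ ENNReal.ofReal (D * t ^ (-β)) := by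
      rw [← ofReal_measureReal]
      exact ENNReal.ofReal_le_ofReal (h t ht0)
    calc _ ≤ ENNReal.ofReal (D * t ^ (-β)) * ENNReal.ofReal (t ^ (ε - 1)) := by gcongr
      _ = _ := by
        rw [← ENNReal.ofReal_mul' (Real.rpow_nonneg ht0.le _), mul_assoc, ← Real.rpow_add ht0]
        ring_nf

theorem measureReal_stable_le {μ : Measure ℝ} [IsProbabilityMeasure μ] (hC : 0 < C) (hβ : 0 < β)
    (hμ : ∀ t, charFun μ t = Complex.exp (stableExponent C β t)) (r : ℝ) (hr : 0 < r) :
    μ.real {x | r < |x|} ≤ 2 * (C * 2 ^ β) * r ^ (-β) := by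
  refine (measureReal_abs_gt_le_integral_charFun hr).trans ?_
  have hb : ∀ t ∈ Set.uIoc (-2 * r⁻¹) (2 * r⁻¹),
      ‖1 - charFun μ t‖ ≤ C * (2 * r⁻¹) ^ β := fun t ht => by
    rw [neg_mul, Set.uIoc_of_le (by linarith [inv_pos.2 hr])] at ht
    have h1 : |t| ≤ 2 * r⁻¹ := abs_le.2 ⟨ht.1.le, ht.2⟩
    have h2 : |t| ^ β ≤ (2 * r⁻¹) ^ β := by gcongr
    have h3 := Real.rpow_nonneg (abs_nonneg t) β
    rw [hμ, stableExponent, ← Complex.ofReal_exp, ← Complex.ofReal_one, ← Complex.ofReal_sub,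
      Complex.norm_real, Real.norm_of_nonneg (by
        rw [sub_nonneg, Real.exp_le_one_iff]; nlinarith)]
    have := Real.add_one_le_exp (-C * |t| ^ β)
    nlinarith
  have := intervalIntegral.norm_integral_le_of_norm_le_const hb
  have hlen : |2 * r⁻¹ - -2 * r⁻¹| = 4 * r⁻¹ := by
    rw [abs_of_nonneg (by linarith [inv_pos.2 hr])]; ring
  rw [hlen] at this
  calc 2⁻¹ * r * ‖∫ t in (-2 * r⁻¹)..(2 * r⁻¹), 1 - charFun μ t‖
      ≤ 2⁻¹ * r * (C * (2 * r⁻¹) ^ β * (4 * r⁻¹)) := by gcongr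
    _ = 2 * (C * 2 ^ β) * r ^ (-β) := by
      rw [Real.mul_rpow (by norm_num) (inv_nonneg.2 hr.le), Real.inv_rpow hr.le,
        Real.rpow_neg hr.le]
      field_simp
      ring

theorem isTemperedLevyExponent_stable (hC : 0 < C) (hβ : 0 < β)
    (h1 : IsCharFun fun ξ : ℝ => Complex.exp (stableExponent C β ξ)) :
    IsTemperedLevyExponent (stableExponent C β) := by
  obtain ⟨μ, hμ, hchar⟩ := h1
  beta_reduce at hchar
  -- Tails of order `r^(-β)` give all moments of order below `β`; `β / 2` is one choice. The
  -- convolution root of order `N` is `μ` dilated by `N^(-1/β)`.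
  refine ⟨continuous_stableExponent hβ, stableExponent_zero hβ, μ, hμ, fun N hN => ?_, hchar,
    β / 2, by positivity, integrable_rpow_of_measureReal_le (by positivity) (half_lt_self hβ)
      (measureReal_stable_le hC hβ hchar)⟩
  have hN0 : (0 : ℝ) < N := by exact_mod_cast hN
  have hν : IsProbabilityMeasure (μ.map fun x => ((N : ℝ)⁻¹) ^ (1 / β) * x) :=
    Measure.isProbabilityMeasure_map (by fun_prop)
  refine ⟨_, hν, ?_⟩
  have : IsProbabilityMeasure ((Measure.pi fun _ : Fin N =>
      μ.map fun x => ((N : ℝ)⁻¹) ^ (1 / β) * x).map fun x => ∑ i, x i) :=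
    Measure.isProbabilityMeasure_map (by fun_prop)
  refine Measure.ext_of_charFun (funext fun t => ?_)
  rw [charFun_map_sum_pi, charFun_map_mul, hchar, hchar,
    stableExponent_rpow_mul (inv_nonneg.2 hN0.le) hβ, ← Complex.exp_nat_mul]
  congr 1
  push_cast
  have : (N : ℂ) ≠ 0 := by exact_mod_cast hN0.ne'
  field_simp

end Tempered

/-! ### Integrability of `T`, rescaling, and existence of the stable law -/

section Operators

variable {d : ℕ} {L : 𝓢(Space d, ℝ) →L[ℝ] TempDist d}
  {T : opDomain L →ₗ[ℝ] (Space d →ₘ[volume] ℝ)} {Ψ : ℝ → ℂ} {C β : ℝ}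

/-- Hölder's inequality with `1/p = 1/q + 1/2`, the factor `(1 + ‖x‖)^(-k)` being in `L^q` for
suitable `k`. Exponents `p < 1` are included, as the small `ε` of the moment bound requires. -/
theorem exists_eLpNorm_le_weighted {p : ℝ≥0∞} (hp : p ≤ 2) :
    ∃ (N : ℕ) (A : ℝ≥0∞), A ≠ ⊤ ∧ ∀ f : Space d → ℝ, AEStronglyMeasurable f volume →
      eLpNorm f p volume ≤ A * eLpNorm (fun x => (1 + ‖x‖) ^ N * f x) 2 volume := by
  let q : ℝ≥0∞ := (p⁻¹ - 2⁻¹)⁻¹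
  have hq : ENNReal.HolderTriple q 2 p := ⟨by
    rw [inv_inv, tsub_add_cancel_of_le (ENNReal.inv_le_inv.2 hp)]⟩
  obtain ⟨k, hk⟩ := Measure.HasTemperateGrowth.exists_eLpNorm_lt_top q
    (inferInstance : (volume : Measure (Space d)).HasTemperateGrowth)
  refine ⟨k, _, hk.ne, fun f hf => ?_⟩
  have hpos : ∀ x : Space d, 0 < 1 + ‖x‖ := fun x => by positivity
  have hc : Continuous fun x : Space d => (1 + ‖x‖) ^ (-k : ℝ) :=
    .rpow_const (by fun_prop) fun x => .inl (hpos x).ne'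
  calc eLpNorm f p volume
      = eLpNorm ((fun x : Space d => (1 + ‖x‖) ^ (-k : ℝ)) • fun x => (1 + ‖x‖) ^ k * f x)
          p volume := by
        refine congrArg (eLpNorm · p volume) (funext fun x => ?_)
        simp only [Pi.smul_apply', smul_eq_mul, Real.rpow_neg (hpos x).le, Real.rpow_natCast]
        field_simp [(hpos x).ne']
    _ ≤ _ := eLpNorm_smul_le_mul_eLpNorm
        ((Continuous.aestronglyMeasurable (by fun_prop)).mul hf) hc.aestronglyMeasurable

theorem ContinuousToRapidDecay.continuousToLp (hT : ContinuousToRapidDecay T) {p : ℝ}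
    (hp : p ≤ 2) : ContinuousToLp T p := by
  obtain ⟨N, A, hA, hle⟩ := exists_eLpNorm_le_weighted (d := d) (p := ENNReal.ofReal p)
    (by simpa using ENNReal.ofReal_le_ofReal hp)
  have hm : ∀ φ, AEStronglyMeasurable (T (ofSchwartz L φ)) volume := fun φ =>
    (T (ofSchwartz L φ)).aestronglyMeasurable
  refine ⟨fun φ => ⟨hm φ, (hle _ (hm φ)).trans_lt
    (ENNReal.mul_lt_top hA.lt_top ((hT N).1 φ).2)⟩, fun φ₀ => ?_⟩
  have h0 := ENNReal.Tendsto.const_mul ((hT N).2 φ₀) (Or.inr hA)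
  rw [mul_zero] at h0
  exact tendsto_of_tendsto_of_tendsto_of_le_of_le tendsto_const_nhds h0 (fun _ => zero_le)
    fun φ => hle _ ((hm φ).sub (hm φ₀))

theorem memLp_of_mem_opDomain (hinv : IsLeftInverse T) {p : ℝ} (hT : ContinuousToLp T p)
    (u : opDomain L) : MemLp (T u) (ENNReal.ofReal p) volume := by
  obtain ⟨u, hu⟩ := u
  obtain ⟨_, ⟨φ, rfl⟩, _, ⟨ψ, rfl⟩, rfl⟩ := Submodule.mem_sup.1 hu
  have h : T ⟨_, hu⟩ = T (ofSchwartz L φ) + T (adjointTo L ψ) := by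
    rw [← map_add]; rfl
  rw [h]
  have h2 : MemLp (T (adjointTo L ψ)) (ENNReal.ofReal p) volume :=
    (memLp_congr_ae (hinv ψ)).2 (ψ.memLp _)
  exact (memLp_congr_ae (AEEqFun.coeFn_add _ _)).2 ((hT.1 φ).add h2)

theorem tendsto_exp_stable_of_eLpNorm {X : Type*} [MeasurableSpace X] {m : Measure X}
    {f : ℕ → X → ℝ} (hβ : 0 < β) (hf : ∀ n, MemLp (f n) (ENNReal.ofReal β) m)
    (h : Tendsto (fun n => eLpNorm (f n) (ENNReal.ofReal β) m) atTop (𝓝 0)) (t : ℝ) :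
    Tendsto (fun n => Complex.exp (∫ x, stableExponent C β (t * f n x) ∂m)) atTop (𝓝 1) := by
  have h1 : ∀ n, (eLpNorm (f n) (ENNReal.ofReal β) m).toReal ^ β = ∫ x, ‖f n x‖ ^ β ∂m :=
    fun n => by
      have h0 : 0 ≤ ∫ x, ‖f n x‖ ^ β ∂m :=
        integral_nonneg fun x => Real.rpow_nonneg (norm_nonneg _) _
      rw [(hf n).eLpNorm_eq_integral_rpow_norm (by simpa using hβ) ENNReal.ofReal_ne_top,
        ENNReal.toReal_ofReal hβ.le, ENNReal.toReal_ofReal (Real.rpow_nonneg h0 _),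
        ← Real.rpow_mul h0, inv_mul_cancel₀ hβ.ne', Real.rpow_one]
  have h2 : Tendsto (fun n => ∫ x, ‖f n x‖ ^ β ∂m) atTop (𝓝 0) := by
    have := ((ENNReal.tendsto_toReal ENNReal.zero_ne_top).comp h).rpow_const (p := β)
      (Or.inr hβ.le)
    simpa only [Function.comp_def, h1, ENNReal.toReal_zero, Real.zero_rpow hβ.ne'] using this
  have h3 : ∀ n, ∫ x, stableExponent C β (t * f n x) ∂m
      = ((-C * |t| ^ β * ∫ x, ‖f n x‖ ^ β ∂m : ℝ) : ℂ) := fun n => by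
    rw [← integral_const_mul, ← integral_complex_ofReal]
    refine integral_congr_ae (ae_of_all _ fun x => ?_)
    simp only [stableExponent, abs_mul, Real.norm_eq_abs,
      Real.mul_rpow (abs_nonneg t) (abs_nonneg _), mul_assoc]
  simp only [h3]
  have h4 := (Complex.continuous_exp.tendsto _).comp
    ((Complex.continuous_ofReal.tendsto _).comp (h2.const_mul (-C * |t| ^ β)))
  simpa [Function.comp_def] using h4

theorem tendsto_eLpNorm_sub_schwartz (p : ℝ≥0∞) {φ : ℕ → 𝓢(Space d, ℝ)} {φ₀ : 𝓢(Space d, ℝ)}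
    (h : Tendsto φ atTop (𝓝 φ₀)) :
    Tendsto (fun n => eLpNorm (φ n - φ₀ : 𝓢(Space d, ℝ)) p volume) atTop (𝓝 0) := by
  obtain ⟨k, A, hA⟩ := SchwartzMap.eLpNorm_le_seminorm ℝ (E := Space d) ℝ p volume
  have hsub : Tendsto (fun n => φ n - φ₀) atTop (𝓝 0) := by
    simpa using h.sub_const φ₀
  have hcont : Continuous
      ⇑((Finset.Iic (k, 0)).sup (schwartzSeminormFamily ℝ (Space d) ℝ)) :=
    Seminorm.continuous_finsetSup fun i _ =>
      (schwartz_withSeminorms ℝ (Space d) ℝ).continuous_seminorm i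
  have h1 : Tendsto (fun n => A * ENNReal.ofReal
      ((Finset.Iic (k, 0)).sup (schwartzSeminormFamily ℝ (Space d) ℝ) (φ n - φ₀)))
      atTop (𝓝 0) := by
    have h2 := (hcont.tendsto 0).comp hsub
    rw [map_zero] at h2
    have h3 := ENNReal.Tendsto.const_mul (ENNReal.tendsto_ofReal h2)
      (Or.inr (ENNReal.coe_ne_top (r := A)))
    simpa using h3
  exact tendsto_of_tendsto_of_tendsto_of_le_of_le tendsto_const_nhds h1 (fun _ => zero_le)
    fun n => hA _

theorem levyFunctional_congr {f g : Space d → ℝ} (h : f =ᵐ[volume] g) :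
    levyFunctional Ψ f = levyFunctional Ψ g := by
  unfold levyFunctional
  congr 1
  exact integral_congr_ae (h.mono fun x hx => by simp only [hx])

/-- The characteristic functional of the rescaled process. -/
theorem charFunctional_rescale {γ : ℝ} (hhom : IsHomogeneousInverse T (-γ)) {Ω : Type*}
    [MeasurableSpace Ω] {P : Measure Ω} {s : GenProcess d P} (hs : IsLinearProcess T Ψ s)
    {a : ℝ} (ha : 0 < a) (φ : 𝓢(Space d, ℝ)) :
    charFunctional (rescale s (γ + d * (1 / β - 1)) a) φ
      = Complex.exp (∫ x, (((a ^ d)⁻¹ : ℝ) : ℂ)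
          * Ψ ((a ^ d : ℝ) ^ (1 / β) * T (ofSchwartz L φ) x)) := by
  set c : ℝ := a ^ (γ + d * (1 / β - 1)) * a ^ d with hc
  -- The choice of `H_loc`: the exponents `γ + d/β - d`, `d` and `-γ` add up to `d/β`.
  have hcγ : c * a ^ (-γ) = (a ^ d : ℝ) ^ (1 / β) := by
    rw [hc, ← Real.rpow_natCast a d, ← Real.rpow_mul ha.le, ← Real.rpow_add ha,
      ← Real.rpow_add ha]
    congr 1
    ring
  have h1 : (rescale s (γ + d * (1 / β - 1)) a).toLin φ = s.toLin (c • dilate a φ) := by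
    rw [map_smul]; rfl
  have hT : T (ofSchwartz L (c • dilate a φ)) =ᵐ[volume]
      fun x => (a ^ d : ℝ) ^ (1 / β) * T (ofSchwartz L φ) (a • x) := by
    have h2 := hhom a⁻¹ (inv_pos.2 ha) φ
    simp only [inv_inv, neg_neg] at h2
    rw [map_smul, map_smul]
    filter_upwards [AEEqFun.coeFn_smul c (T (ofSchwartz L (dilate a φ))), h2] with x h3 h4
    rw [h3, Pi.smul_apply, h4, smul_eq_mul, ← hcγ, Real.inv_rpow ha.le, Real.rpow_neg ha.le]
    ring
  unfold charFunctional
  rw [h1]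
  refine (hs _).trans ((levyFunctional_congr hT).trans ?_)
  unfold levyFunctional
  rw [Measure.integral_comp_smul volume
    (fun x => Ψ ((a ^ d : ℝ) ^ (1 / β) * T (ofSchwartz L φ) x)) a, integral_const_mul]
  simp [abs_of_pos ha]

/-- The bounds on `Ψ` and the integrability of `T φ` that make the scaling limit work. -/
theorem exists_exponent_bound (hβ : 0 < β) (hβ2 : β ≤ 2) (hΨt : IsTemperedLevyExponent Ψ)
    (hΨ : Asymptotics.IsEquivalent (Bornology.cobounded ℝ) Ψ (stableExponent C β))
    (hT : ContinuousToRapidDecay T ∨ (ContinuousToLp T β ∧ IsAdmissible Ψ β)) :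
    ContinuousToLp T β ∧ ∃ ε K : ℝ, 0 < ε ∧ ε ≤ β ∧ ContinuousToLp T ε ∧
      ∀ ξ : ℝ, ‖Ψ ξ‖ ≤ K * (|ξ| ^ ε + |ξ| ^ β) := by
  -- Rapid decay puts `Tφ` in every `L^p` with `0 < p ≤ 2`, so the `ε` of the moment bound is
  -- allowed; under admissibility `ε = β` suffices.
  rcases hT with hT | ⟨hT, K, hK0, hK⟩
  · obtain ⟨ε, K, hε, hεβ, hK⟩ := hΨt.exists_bound hβ hΨ
    exact ⟨hT.continuousToLp hβ2, ε, K, hε, hεβ, hT.continuousToLp (hεβ.trans hβ2), hK⟩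
  · refine ⟨hT, β, K, hβ, le_rfl, hT, fun ξ => (hK ξ).trans ?_⟩
    have := Real.rpow_nonneg (abs_nonneg ξ) β
    gcongr
    linarith

theorem tendsto_charFunctional_rescale (hd : 0 < d) {γ : ℝ} (hβ : 0 < β) (hβ2 : β ≤ 2)
    (hΨt : IsTemperedLevyExponent Ψ)
    (hΨ : Asymptotics.IsEquivalent (Bornology.cobounded ℝ) Ψ (stableExponent C β))
    (hT : ContinuousToRapidDecay T ∨ (ContinuousToLp T β ∧ IsAdmissible Ψ β))
    (hhom : IsHomogeneousInverse T (-γ)) {Ω : Type*}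
    [MeasurableSpace Ω] {P : Measure Ω} {s : GenProcess d P} (hs : IsLinearProcess T Ψ s)
    (φ : 𝓢(Space d, ℝ)) :
    Tendsto (fun a => charFunctional (rescale s (γ + d * (1 / β - 1)) a) φ) atTop
      (𝓝 (levyFunctional (stableExponent C β) (T (ofSchwartz L φ)))) := by
  obtain ⟨hTβ, ε, K, hε, hεβ, hTε, hK⟩ := exists_exponent_bound hβ hβ2 hΨt hΨ hT
  have h1 := tendsto_integral_inv_mul_comp hβ hε hεβ hΨt.1 hΨt.2.1 hK hΨ
    (T (ofSchwartz L φ)).aestronglyMeasurable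
    (integrable_rpow_of_memLp hε (hTε.1 φ)) (integrable_rpow_of_memLp hβ (hTβ.1 φ))
  have h2 := ((Complex.continuous_exp.tendsto _).comp h1).comp
    (tendsto_pow_atTop (α := ℝ) hd.ne')
  refine h2.congr' ?_
  filter_upwards [eventually_gt_atTop 0] with a ha
  exact (charFunctional_rescale hhom hs ha φ).symm

theorem charFunctional_rescale_stable (hβ : 0 < β) {γ : ℝ} (hhom : IsHomogeneousInverse T (-γ))
    {Ω : Type*} [MeasurableSpace Ω] {P : Measure Ω} {s : GenProcess d P}
    (hs : IsLinearProcess T (stableExponent C β) s) {a : ℝ} (ha : 0 < a)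
    (φ : 𝓢(Space d, ℝ)) :
    charFunctional (rescale s (γ + d * (1 / β - 1)) a) φ = charFunctional s φ := by
  have had : (0 : ℝ) < a ^ d := pow_pos ha d
  rw [charFunctional_rescale hhom hs ha, hs φ]
  unfold levyFunctional
  congr 1
  refine integral_congr_ae (ae_of_all _ fun x => ?_)
  simp only
  rw [stableExponent_rpow_mul had.le hβ, ← mul_assoc, ← Complex.ofReal_mul,
    inv_mul_cancel₀ had.ne', Complex.ofReal_one, one_mul]

theorem integral_stableExponent_mul {X : Type*} [MeasurableSpace X] {m : Measure X} {f : X → ℝ}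
    (hβ : 0 < β) (t : ℝ) :
    ∫ x, stableExponent C β (t * f x) ∂m
      = stableExponent C β ((∫ x, ‖f x‖ ^ β ∂m) ^ (1 / β) * t) := by
  rw [stableExponent_rpow_mul (integral_nonneg fun x => Real.rpow_nonneg (norm_nonneg _) _) hβ,
    stableExponent, ← Complex.ofReal_mul, mul_comm, ← integral_const_mul,
    ← integral_complex_ofReal]
  refine integral_congr_ae (ae_of_all _ fun x => ?_)
  simp only [stableExponent, abs_mul, Real.norm_eq_abs,
      Real.mul_rpow (abs_nonneg t) (abs_nonneg _), mul_assoc]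

theorem integral_norm_rpow_pos {X : Type*} [MeasurableSpace X] {m : Measure X} {f : X →ₘ[m] ℝ}
    (hβ : 0 < β) (hf : MemLp f (ENNReal.ofReal β) m) (hne : f ≠ 0) :
    0 < ∫ x, ‖f x‖ ^ β ∂m := by
  have hnn : 0 ≤ fun x => ‖f x‖ ^ β := fun x => Real.rpow_nonneg (norm_nonneg _) _
  refine lt_of_le_of_ne (integral_nonneg hnn) fun h0 => hne ?_
  have h1 := (integral_eq_zero_iff_of_nonneg hnn (integrable_rpow_of_memLp hβ hf)).1 h0.symm
  refine AEEqFun.ext ?_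
  filter_upwards [h1, AEEqFun.coeFn_zero (μ := m) (β := ℝ) (α := X)] with x hx h2
  rw [h2]
  exact norm_eq_zero.1 ((Real.rpow_eq_zero (norm_nonneg _) hβ.ne').1 hx)

/-- The stable law exists, as the limit of the law of `⟨a ^ H s(· / a), φ⟩`. -/
theorem isCharFun_stable_of_linearProcess (hd : 0 < d) {γ : ℝ} (hβ : 0 < β) (hβ2 : β ≤ 2)
    (hΨt : IsTemperedLevyExponent Ψ)
    (hΨ : Asymptotics.IsEquivalent (Bornology.cobounded ℝ) Ψ (stableExponent C β))
    (hT : ContinuousToRapidDecay T ∨ (ContinuousToLp T β ∧ IsAdmissible Ψ β))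
    (hT_ne : ∃ φ : 𝓢(Space d, ℝ), T (ofSchwartz L φ) ≠ 0)
    (hhom : IsHomogeneousInverse T (-γ)) {Ω : Type*}
    [MeasurableSpace Ω] {P : Measure Ω} [IsProbabilityMeasure P] {s : GenProcess d P}
    (hs : IsLinearProcess T Ψ s) :
    IsCharFun fun ξ : ℝ => Complex.exp (stableExponent C β ξ) := by
  obtain ⟨φ, hφ⟩ := hT_ne
  have hTβ := (exists_exponent_bound hβ hβ2 hΨt hΨ hT).1
  set κ := (∫ x, ‖T (ofSchwartz L φ) x‖ ^ β) ^ (1 / β) with hκ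
  have hκ0 : 0 < κ := Real.rpow_pos_of_pos (integral_norm_rpow_pos hβ (hTβ.1 φ) hφ) _
  have hlim : ∀ t : ℝ, levyFunctional (stableExponent C β) (T (ofSchwartz L (t • φ)))
      = Complex.exp (stableExponent C β (κ * t)) := fun t => by
    rw [hκ, ← integral_stableExponent_mul hβ, map_smul, map_smul,
      levyFunctional_congr (AEEqFun.coeFn_smul t _)]
    rfl
  have hκchar : IsCharFun fun t : ℝ => Complex.exp (stableExponent C β (κ * t)) := by
    -- The limit is taken along integer scales; at `n = 0` the process is degenerate but still has a
    -- law. Dilating by `κ⁻¹` afterwards normalizes the scale.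
    refine IsCharFun.of_tendsto (f := fun n t =>
      charFunctional (rescale s (γ + d * (1 / β - 1)) n) (t • φ)) (fun n => ?_) ?_ fun t => ?_
    · refine ⟨P.map ((rescale s (γ + d * (1 / β - 1)) n).toLin φ),
        Measure.isProbabilityMeasure_map (AEEqFun.aemeasurable _), fun t => ?_⟩
      rw [← expectExp_smul_eq_charFun, ← map_smul]
      rfl
    · exact (Complex.continuous_exp.comp ((continuous_stableExponent hβ).comp
        (continuous_const.mul continuous_id))).continuousAt
    · rw [← hlim]
      exact (tendsto_charFunctional_rescale hd hβ hβ2 hΨt hΨ hT hhom hs (t • φ)).comp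
        tendsto_natCast_atTop_atTop
  convert hκchar.comp_inner κ⁻¹ using 3 with ξ
  simp only [RCLike.inner_apply, conj_trivial]
  rw [mul_comm ξ, mul_inv_cancel_left₀ hκ0.ne']

/-- Sequential continuity in probability of a stable field along an operator `A` on Schwartz
functions whose composition with `T` is continuous to `L ^ β`. -/
theorem seqContinuous_stable (hβ : 0 < β) {Ω : Type*} [MeasurableSpace Ω] {P : Measure Ω}
    [IsProbabilityMeasure P] {S : opDomain L →ₗ[ℝ] (Ω →ₘ[P] ℝ)}
    (hS : ∀ u, expectExp (S u) = levyFunctional (stableExponent C β) (T u))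
    (hT : ∀ u, MemLp (T u) (ENNReal.ofReal β) volume)
    (A : 𝓢(Space d, ℝ) →ₗ[ℝ] opDomain L) {φ : ℕ → 𝓢(Space d, ℝ)} {φ₀ : 𝓢(Space d, ℝ)}
    (h : Tendsto (fun n => eLpNorm (T (A (φ n - φ₀))) (ENNReal.ofReal β) volume) atTop (𝓝 0)) :
    TendstoInMeasure P (fun n => (S (A (φ n)) : Ω → ℝ)) atTop (S (A φ₀) : Ω → ℝ) := by
  refine tendstoInMeasure_of_tendsto_expectExp fun t => ?_
  refine (tendsto_exp_stable_of_eLpNorm (C := C) hβ (fun n => hT _) h t).congr fun n => ?_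
  rw [← map_sub, ← map_sub, ← map_smul, hS, map_smul,
    levyFunctional_congr (AEEqFun.coeFn_smul t _)]
  rfl

end Operators

end LinearSDE

/-! ### The scaling limit theorem -/

theorem mainTheorem2 {d : ℕ} (hd : 0 < d)
    {Ω₀ : Type*} [MeasurableSpace Ω₀] (P₀ : Measure Ω₀) [IsProbabilityMeasure P₀]
    {Ω : Type*} [MeasurableSpace Ω] (P : Measure Ω) [IsProbabilityMeasure P]
    -- the white noise, its exponent and its index
    (w : GenProcess d P₀) (Ψ : ℝ → ℂ) (hw : IsLevyWhiteNoise w Ψ)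
    (β : ℝ) (hβ : blumenthalGetoorIndex Ψ = β) (hβ_mem : β ∈ Set.Ioc (0 : ℝ) 2)
    -- the operator and the left inverse of its adjoint
    (γ : ℝ) (hγ : 0 ≤ γ)
    (L : 𝓢(Space d, ℝ) →L[ℝ] TempDist d) (hL : IsHomogeneousOp L γ)
    (T : opDomain L →ₗ[ℝ] (Space d →ₘ[volume] ℝ))
    (hT_inv : IsLeftInverse T) (hT_hom : IsHomogeneousInverse T (-γ))
    (hT_ne : ∃ φ : 𝓢(Space d, ℝ), T (ofSchwartz L φ) ≠ 0)
    (hT : ContinuousToRapidDecay T ∨ (ContinuousToLp T β ∧ IsAdmissible Ψ β))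
    -- the linear process
    (s : GenProcess d P) (hs : IsLinearProcess T Ψ s)
    (C : ℝ) (hC : 0 < C)
    (hΨ : Asymptotics.IsEquivalent (Bornology.cobounded ℝ) Ψ (stableExponent C β)) :
    (∃ (Ω' : Type) (_ : MeasurableSpace Ω') (P' : Measure Ω') (_ : IsProbabilityMeasure P')
      (sLim wLim : GenProcess d P'),
      IsLevyWhiteNoise wLim (stableExponent C β) ∧
      IsLinearProcess T (stableExponent C β) sLim ∧
      SolvesSDE T (stableExponent C β) sLim wLim ∧
      ConvergesInLaw (fun a => rescale s (γ + d * (1 / β - 1)) a) atTop sLim ∧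
      IsSelfSimilar sLim (γ + d * (1 / β - 1))) ∧
    IsLocallySelfSimilar s (γ + d * (1 / β - 1)) := by
  classical
  obtain ⟨hβ0, hβ2⟩ := hβ_mem
  have hchar := isCharFun_stable_of_linearProcess hd hβ0 hβ2 hw.1 hΨ hT hT_ne hT_hom hs
  have hTβ := (exists_exponent_bound hβ0 hβ2 hw.1 hΨ hT).1
  have hmem := memLp_of_mem_opDomain hT_inv hTβ
  -- A single field on `𝓢 + L*(𝓢)` yields process and noise on the same space, which makes the
  -- equation hold by definition.
  obtain ⟨Ω', mΩ', P', hP', S, hS⟩ := exists_stable_field T hβ0 hchar hmem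
  let sLim : GenProcess d P' :=
    { toLin := S ∘ₗ ofSchwartz L
      seqContinuous := fun φ φ₀ h =>
        seqContinuous_stable hβ0 hS hmem (ofSchwartz L) <| by
          refine ((hTβ.2 φ₀).comp h).congr fun n => ?_
          rw [map_sub, map_sub]
          exact (eLpNorm_congr_ae (AEEqFun.coeFn_sub _ _)).symm }
  let wLim : GenProcess d P' :=
    { toLin := S ∘ₗ adjointTo L
      seqContinuous := fun φ φ₀ h =>
        seqContinuous_stable hβ0 hS hmem (adjointTo L) <|
          (tendsto_eLpNorm_sub_schwartz (ENNReal.ofReal β) h).congr fun n =>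
            (eLpNorm_congr_ae (hT_inv (φ n - φ₀))).symm }
  have hsLim : IsLinearProcess T (stableExponent C β) sLim := fun φ => hS _
  have hconv : ConvergesInLaw (fun a => rescale s (γ + d * (1 / β - 1)) a) atTop sLim :=
    convergesInLaw_of_tendsto_charFunctional fun φ => by
      rw [hsLim φ]
      exact tendsto_charFunctional_rescale hd hβ0 hβ2 hw.1 hΨ hT hT_hom hs φ
  refine ⟨⟨Ω', mΩ', P', hP', sLim, wLim,
    ⟨isTemperedLevyExponent_stable hC hβ0 hchar, fun φ =>
      (hS _).trans (levyFunctional_congr (hT_inv φ))⟩, hsLim,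
    ⟨S, fun _ => rfl, hS, fun _ => rfl⟩, hconv, fun a ha =>
      equalInLaw_of_charFunctional_eq fun φ =>
        charFunctional_rescale_stable hβ0 hT_hom hsLim ha φ⟩,
    Ω', mΩ', P', hP', sLim, fun h0 => ?_, hconv⟩
  obtain ⟨φ, hφ⟩ := hT_ne
  -- Were the limit zero, `exp(-C‖Tφ‖_β^β)` would be `1`, against `Tφ ≠ 0` and `C > 0`.
  have h1 : expectExp (S (ofSchwartz L φ)) = 1 := by
    have : S (ofSchwartz L φ) = 0 := LinearMap.congr_fun h0 φ
    rw [this, expectExp_congr AEEqFun.coeFn_zero]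
    simp
  rw [hS] at h1
  have h2 := integral_stableExponent_mul (C := C) (m := volume)
    (f := T (ofSchwartz L φ)) hβ0 1
  simp only [one_mul, mul_one] at h2
  have hκ := integral_norm_rpow_pos hβ0 (hTβ.1 φ) hφ
  rw [h2, stableExponent, ← Complex.ofReal_exp, Complex.ofReal_eq_one, Real.exp_eq_one_iff] at h1
  have h3 : 0 < |(∫ x, ‖T (ofSchwartz L φ) x‖ ^ β) ^ (1 / β)| ^ β := by positivity
  nlinarith
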